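/- Let $\mathbb D$ be the open unit disk. A finite Blaschke product of order $n\ge 1$ is a function $B(z)=\lambda\prod_{k=1}^n\frac{z-\alpha_k}{1-\overline{\alpha_k}z}$ on $\mathbb D$ with $|\lambda|=1$ and $|\alpha_k|<1$. Let $I$ be a finite Blaschke product of order $n$ such that $0$ is not a critical value of $I$ in $\mathbb D$ (for example, $I$ normalized: $I(0)=0$, $I'(0)>0$, and all zeros of $I$ simple). A branch of $I^{-1}$ at $0$ is a germ at $0$ of an analytic $\mathbb D$-valued function $g$ with $I(g(w))=w$ near $0$. Let $G_I$ be the group of permutations of these branches given by analytic continuation along loops based at $0$ in $\mathbb D$ minus the set of critical values of $I$. A factorization of $I$ is a pair $(J,b)$ of finite Blaschke products with $I=J\circ b$ on $\mathbb D$; it is non-trivial if $J$ and $b$ both have order greater than $1$, and trivial otherwise. Factorizations $(J,b)$ and $(J',b')$ are equivalent if $b'=\varphi\circ b$ and $J=J'\circ\varphi$ for some automorphism $\varphi$ of $\mathbb D$. A normal subgroup $N$ of $G_I$ and a factorization $(J,b)$ are associated if any two branches $g,h$ lie in the same $N$-orbit exactly when $b\circ g=b\circ h$ near $0$. Put $N_b=\{\sigma\in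 G_I : b\circ\sigma(g)=b\circ g \text{ near } 0 \text{ for every branch } g\}$. Then: 1. Every normal subgroup $N$ of $G_I$ has an associated factorization $(J,b)$, in which $b$ can be taken to be given by $b(g(w))=\prod_{h\in N\cdot g}h(w)$ for every branch $g$ and all $w$ near $0$. Any two factorizations associated with the same $N$ are equivalent. 2. For every factorization $(J,b)$ of $I$, the subgroup $N_b$ is normal in $G_I$ and is associated with $(J,b)$. If $(J,b)$ is non-trivial, then $N_b\neq\{1\}$, $N_b\ne G_I$, and $(J,b)$ is equivalent to a factorization $(J',b')$ constructed from $N_b$ by the formula in 1. Thus every non-trivial factorization of $I$ is obtained, up to equivalence, from the normal subgroups of $G_I$. 3. Two factorizations $(J,b)$ and $(J',b')$ of $I$ are equivalent if and only if $N_b=N_{b'}$; in particular, inequivalent factorizations correspond to different normal subgroups. 4. There exist a normalized finite Blaschke product $I$ and a normal subgroup $N$ of $G_I$ with $N\neq\{1\}$ and $N\neq G_I$ that is associated with a trivial factorization of $I$. -/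

import Mathlib

open Set Filter Topology

namespace FiniteBlaschke

/-- The open unit disk. -/
abbrev disk : Set ℂ := Metric.ball (0 : ℂ) 1

/-- `B` is, on the open unit disk, a finite Blaschke product of order `n` (a positive integer).
Only the restriction of `B` to the disk is meaningful. -/
def IsBlaschke (n : ℕ) (B : ℂ → ℂ) : Prop :=
  0 < n ∧ ∃ (c : ℂ) (α : Fin n → ℂ), ‖c‖ = 1 ∧ (∀ k, ‖α k‖ < 1) ∧
    ∀ z ∈ disk, B z = c * ∏ k, (z - α k) / (1 - (starRingEnd ℂ) (α k) * z)

/-- The critical values of `B` in the disk: images of the zeros of `B'` in the disk. -/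
def criticalValues (B : ℂ → ℂ) : Set ℂ :=
  {w | ∃ z ∈ disk, deriv B z = 0 ∧ B z = w}

/-- Normalization: `I(0) = 0`, `I'(0) > 0`, and all zeros of `I` in the disk are simple. -/
def IsNormalized (I : ℂ → ℂ) : Prop :=
  I 0 = 0 ∧ (0 < (deriv I 0).re ∧ (deriv I 0).im = 0) ∧ (0 : ℂ) ∉ criticalValues I

/-- The branches of `I⁻¹` at `0`: germs at `0` of analytic functions `f`, with values in the
disk, such that `I (f w) = w` for all `w` near `0`. -/
def Branch (I : ℂ → ℂ) : Type :=
  {g : Germ (𝓝 (0 : ℂ)) ℂ // ∃ f : ℂ → ℂ, AnalyticAt ℂ f 0 ∧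
    (∀ᶠ w in 𝓝 (0 : ℂ), f w ∈ disk ∧ I (f w) = w) ∧ (f : Germ (𝓝 (0 : ℂ)) ℂ) = g}

/-- Analytic continuation along the loop `γ` based at `0` leads from the germ `g` at `0` to the
germ `h` at `0`: there are functions `f t`, analytic at `γ t`, such that `f s` and `f t` define
the same germ at `γ s` whenever `s` is close to `t`, starting with `g` and ending with `h`. -/
def ContinuesTo (γ : Path (0 : ℂ) 0) (g h : Germ (𝓝 (0 : ℂ)) ℂ) : Prop :=
  ∃ f : unitInterval → ℂ → ℂ,
    (∀ t, AnalyticAt ℂ (f t) (γ t)) ∧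
    (∀ t, ∀ᶠ s in 𝓝 t, f s =ᶠ[𝓝 (γ s)] f t) ∧
    (f 0 : Germ (𝓝 (0 : ℂ)) ℂ) = g ∧ (f 1 : Germ (𝓝 (0 : ℂ)) ℂ) = h

/-- The group `G_I`: the group of permutations of the branches of `I⁻¹` at `0` given by analytic
continuation along the loops based at `0` in the disk with the critical values of `I` removed. -/
def monodromyGroup (I : ℂ → ℂ) : Subgroup (Equiv.Perm (Branch I)) :=
  Subgroup.closure {σ | ∃ γ : Path (0 : ℂ) 0,
    (∀ t, γ t ∈ disk \ criticalValues I) ∧ ∀ g : Branch I, ContinuesTo γ g.1 (σ g).1}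

/-- `I = J ∘ b` on the disk, with `J` and `b` finite Blaschke products. -/
def IsFactorization (I J b : ℂ → ℂ) : Prop :=
  (∃ m, IsBlaschke m J) ∧ (∃ k, IsBlaschke k b) ∧ EqOn I (J ∘ b) disk

/-- A factorization is non-trivial if the order of each factor is greater than `1`. -/
def IsNontrivialFactorization (I J b : ℂ → ℂ) : Prop :=
  (∃ m, 1 < m ∧ IsBlaschke m J) ∧ (∃ k, 1 < k ∧ IsBlaschke k b) ∧ EqOn I (J ∘ b) disk

/-- `J ∘ b` and `J' ∘ b'` are equivalent: they differ by an automorphism `φ` of the disk (a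
Blaschke product of order `1`), in the sense that `b' = φ ∘ b` and `J = J' ∘ φ`. -/
def EquivalentFactorizations (J b J' b' : ℂ → ℂ) : Prop :=
  ∃ φ : ℂ → ℂ, IsBlaschke 1 φ ∧ EqOn b' (φ ∘ b) disk ∧ EqOn J (J' ∘ φ) disk

/-- The normal subgroup `N` and the right factor `b` are associated: the partition of the branches
into `N`-orbits is the partition given by `b`, where `g` and `h` are in the same class when
`b ∘ g = b ∘ h` near `0`. -/
def Associated {I : ℂ → ℂ} (N : Subgroup (monodromyGroup I)) (b : ℂ → ℂ) : Prop :=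
  ∀ g h : Branch I, h ∈ MulAction.orbit N g ↔ Germ.map b h.1 = Germ.map b g.1

/-- `b` is given by the explicit formula `b (g w) = ∏ h w` (for every branch `g` and all `w` near
`0`), where `h` runs over the finitely many branches in the `N`-orbit of `g`. -/
def IsOrbitProduct {I : ℂ → ℂ} (N : Subgroup (monodromyGroup I)) (b : ℂ → ℂ) : Prop :=
  ∀ g : Branch I, Germ.map b g.1 = ∏ᶠ h ∈ MulAction.orbit N g, h.1

/-- The subgroup of `G_I` of all elements that map every class of the partition given by `b` to
itself. -/
def factorSubgroup (I b : ℂ → ℂ) : Subgroup (monodromyGroup I) where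
  carrier := {σ | ∀ g : Branch I, Germ.map b (σ • g).1 = Germ.map b g.1}
  one_mem' := fun g => by rw [one_smul]
  mul_mem' := by
    intro σ τ hσ hτ g
    rw [mul_smul]
    exact (hσ _).trans (hτ g)
  inv_mem' := by
    intro σ hσ g
    have h := hσ (σ⁻¹ • g)
    rw [smul_inv_smul] at h
    exact h.symm

end FiniteBlaschke

/-! Off its finitely many critical values a finite Blaschke product `I` is a covering of the disk,
and analytic continuation of branches of `I⁻¹` is path lifting. A branch is determined by its value
at `0`, so `G_I` acts on the fiber `I⁻¹(0)`.

The fact that makes normal subgroups match factorizations is `IsBlaschke.exists_transitive_cyclic`: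
a loop close to the unit circle acts on the branches as one full cycle `τ`, because the part of the
disk lying over a thin boundary annulus is connected. Given `I = J ∘ b`, monodromy permutes the
classes of `b` (lifts through `I` project to lifts through `J`). If `g` and `h = τ ^ j g` are in one
class, then `τ ^ j` sends `τ ^ i g` to `τ ^ i h`, hence preserves every class. So `factorSubgroup I
b` is transitive on each class, and it recovers `b` up to an automorphism
(`associated_factorSubgroup`).

Conversely, let `N` be normal and `I a = 0`. Products of the Blaschke factor at `a` over the
`N`-orbits do not depend on the path of continuation, and define a finite Blaschke product `C`
(`IsBlaschke.exists_prod_family`). The same product over a whole fiber has modulus `|I|`, so `|I| ≤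
|C|`. Hence `C` has only simple zeros, exactly one orbit of them, and its order is the size of an
orbit. Since `C` is constant on orbits, its generic fibers are exactly the orbits, and `I` factors
through `C` (`IsBlaschke.exists_associated`). By Vieta's formula the orbit product itself is an
automorphism applied to `C`, which yields the explicit formula and uniqueness
(`exists_isOrbitProduct`).

For the last claim, take a cubic with a critical value whose fiber has one double and one simple
point. Its even monodromy permutations form a proper nontrivial normal subgroup that is already
transitive, so the associated factorization is `id ∘ I`. -/

namespace FiniteBlaschke

/-! ### Blaschke factors and behavior at the unit circle -/

/-- The elementary Blaschke factor with zero `α`. -/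
noncomputable def blaschkeFactor (α z : ℂ) : ℂ := (z - α) / (1 - (starRingEnd ℂ) α * z)

/-- The filter of sets containing an annulus `r < ‖z‖ < 1`. -/
noncomputable def boundary : Filter ℂ := comap norm (𝓝[<] (1 : ℝ))

theorem mem_disk {z : ℂ} : z ∈ disk ↔ ‖z‖ < 1 := by simp [disk]

theorem isOpen_disk : IsOpen disk := Metric.isOpen_ball

theorem isPreconnected_disk : IsPreconnected disk := (convex_ball _ _).isPreconnected

theorem zero_mem_disk : (0 : ℂ) ∈ disk := by simp

theorem eventually_boundary_mem_disk : ∀ᶠ z in boundary, z ∈ disk := by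
  have : ∀ᶠ r in 𝓝[<] (1 : ℝ), r < 1 := eventually_mem_nhdsWithin
  filter_upwards [this.comap norm] with z hz using mem_disk.2 hz

theorem eventually_boundary_lt_norm {r : ℝ} (hr : r < 1) : ∀ᶠ z in boundary, r < ‖z‖ := by
  have : ∀ᶠ s in 𝓝[<] (1 : ℝ), r < s := mem_nhdsWithin_of_mem_nhds (lt_mem_nhds hr)
  exact this.comap norm

theorem eventually_boundary_iff {p : ℂ → Prop} :
    (∀ᶠ z in boundary, p z) ↔ ∃ r < 1, 0 < r ∧ ∀ z ∈ disk, r < ‖z‖ → p z := by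
  constructor
  · intro h
    rw [boundary, eventually_comap] at h
    obtain ⟨r, hr, hr'⟩ := (mem_nhdsLT_iff_exists_Ioo_subset (a := (1 : ℝ))).1 h
    refine ⟨max r (1 / 2), max_lt hr (by norm_num), lt_max_of_lt_right (by norm_num), ?_⟩
    intro z hz hz'
    exact hr' ⟨(le_max_left _ _).trans_lt hz', mem_disk.1 hz⟩ z rfl
  · rintro ⟨r, hr, -, h⟩
    filter_upwards [eventually_boundary_mem_disk, eventually_boundary_lt_norm hr] with z hz hz'
      using h z hz hz'

theorem tendsto_norm_boundary : Tendsto (norm : ℂ → ℝ) boundary (𝓝 1) :=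
  tendsto_comap.mono_right nhdsWithin_le_nhds

theorem tendsto_boundary_iff {ι : Type*} {l : Filter ι} {f : ι → ℂ} (hf : ∀ᶠ i in l, f i ∈ disk) :
    Tendsto f l boundary ↔ Tendsto (fun i => ‖f i‖) l (𝓝 1) := by
  rw [boundary, tendsto_comap_iff]
  constructor
  · intro h
    exact h.mono_right nhdsWithin_le_nhds
  · intro h
    exact tendsto_nhdsWithin_iff.2 ⟨h, hf.mono fun i hi => mem_disk.1 hi⟩

theorem one_sub_conj_mul_ne_zero {α z : ℂ} (hα : ‖α‖ < 1) (hz : ‖z‖ ≤ 1) :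
    1 - (starRingEnd ℂ) α * z ≠ 0 := by
  intro h
  have h1 : (starRingEnd ℂ) α * z = 1 := (sub_eq_zero.1 h).symm
  have h2 : ‖(starRingEnd ℂ) α * z‖ = 1 := by rw [h1]; simp
  rw [norm_mul, RCLike.norm_conj] at h2
  nlinarith [norm_nonneg α, norm_nonneg z]

/-- Controls moduli on both sides of the unit circle: it gives `|blaschkeFactor α z| < 1` inside,
and outside it keeps the roots of the fiber polynomials away. -/
theorem normSq_one_sub_conj_mul_sub (α z : ℂ) :
    ‖1 - (starRingEnd ℂ) α * z‖ ^ 2 - ‖z - α‖ ^ 2 = (1 - ‖α‖ ^ 2) * (1 - ‖z‖ ^ 2) := by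
  simp only [← Complex.normSq_eq_norm_sq, Complex.normSq_apply]
  simp
  ring

theorem one_sub_norm_blaschkeFactor_sq {α z : ℂ} (hα : ‖α‖ < 1) (hz : ‖z‖ ≤ 1) :
    1 - ‖blaschkeFactor α z‖ ^ 2 =
      (1 - ‖α‖ ^ 2) * (1 - ‖z‖ ^ 2) / ‖1 - (starRingEnd ℂ) α * z‖ ^ 2 := by
  have h := norm_ne_zero_iff.2 (one_sub_conj_mul_ne_zero hα hz)
  rw [← normSq_one_sub_conj_mul_sub, blaschkeFactor, norm_div, div_pow, sub_div,
    div_self (pow_ne_zero 2 h)]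

theorem norm_blaschkeFactor_lt_one {α z : ℂ} (hα : ‖α‖ < 1) (hz : ‖z‖ < 1) :
    ‖blaschkeFactor α z‖ < 1 := by
  have h := norm_pos_iff.2 (one_sub_conj_mul_ne_zero hα hz.le)
  have h1 := one_sub_norm_blaschkeFactor_sq hα hz.le
  have h2 : 0 < (1 - ‖α‖ ^ 2) * (1 - ‖z‖ ^ 2) / ‖1 - (starRingEnd ℂ) α * z‖ ^ 2 := by
    have : 0 < 1 - ‖α‖ ^ 2 := by nlinarith [norm_nonneg α]
    have : 0 < 1 - ‖z‖ ^ 2 := by nlinarith [norm_nonneg z]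
    positivity
  nlinarith [norm_nonneg (blaschkeFactor α z)]

theorem blaschkeFactor_mem_disk {α z : ℂ} (hα : α ∈ disk) (hz : z ∈ disk) :
    blaschkeFactor α z ∈ disk :=
  mem_disk.2 (norm_blaschkeFactor_lt_one (mem_disk.1 hα) (mem_disk.1 hz))

theorem blaschkeFactor_eq_zero_iff {α z : ℂ} (hα : α ∈ disk) (hz : z ∈ disk) :
    blaschkeFactor α z = 0 ↔ z = α := by
  have h := one_sub_conj_mul_ne_zero (mem_disk.1 hα) (mem_disk.1 hz).le
  simp [blaschkeFactor, h, sub_eq_zero]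

@[simp] theorem blaschkeFactor_self (α : ℂ) : blaschkeFactor α α = 0 := by simp [blaschkeFactor]

theorem analyticOnNhd_blaschkeFactor {α : ℂ} (hα : α ∈ disk) :
    AnalyticOnNhd ℂ (blaschkeFactor α) disk := by
  intro z hz
  have h := one_sub_conj_mul_ne_zero (mem_disk.1 hα) (mem_disk.1 hz).le
  exact (by fun_prop : AnalyticAt ℂ (fun z => z - α) z).div
    (by fun_prop : AnalyticAt ℂ (fun z => 1 - (starRingEnd ℂ) α * z) z) h

theorem tendsto_norm_blaschkeFactor {α : ℂ} (hα : α ∈ disk) :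
    Tendsto (fun z => ‖blaschkeFactor α z‖) boundary (𝓝 1) := by
  have hα' := mem_disk.1 hα
  have hlow : ∀ᶠ z in boundary,
      1 - (1 - ‖α‖ ^ 2) * (1 - ‖z‖ ^ 2) / (1 - ‖α‖) ^ 2 ≤ ‖blaschkeFactor α z‖ ∧
      ‖blaschkeFactor α z‖ ≤ 1 := by
    filter_upwards [eventually_boundary_mem_disk] with z hz
    have hz' := mem_disk.1 hz
    have h1 := one_sub_norm_blaschkeFactor_sq hα' hz'.le
    have h2 := norm_blaschkeFactor_lt_one hα' hz'
    have h3 : 1 - ‖α‖ ≤ ‖1 - (starRingEnd ℂ) α * z‖ := by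
      have := norm_sub_norm_le (1 : ℂ) ((starRingEnd ℂ) α * z)
      rw [norm_mul, RCLike.norm_conj, norm_one] at this
      nlinarith [norm_nonneg α, norm_nonneg z]
    have h4 : (1 - ‖α‖ ^ 2) * (1 - ‖z‖ ^ 2) / ‖1 - (starRingEnd ℂ) α * z‖ ^ 2 ≤
        (1 - ‖α‖ ^ 2) * (1 - ‖z‖ ^ 2) / (1 - ‖α‖) ^ 2 := by
      have : 0 < 1 - ‖α‖ := by linarith
      have : 0 ≤ 1 - ‖α‖ ^ 2 := by nlinarith [norm_nonneg α]
      have : 0 ≤ 1 - ‖z‖ ^ 2 := by nlinarith [norm_nonneg z]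
      gcongr
    refine ⟨?_, h2.le⟩
    nlinarith [norm_nonneg (blaschkeFactor α z)]
  refine tendsto_of_tendsto_of_tendsto_of_le_of_le' ?_ tendsto_const_nhds
    (hlow.mono fun _ h => h.1) (hlow.mono fun _ h => h.2)
  have : Tendsto (fun z : ℂ => 1 - (1 - ‖α‖ ^ 2) * (1 - ‖z‖ ^ 2) / (1 - ‖α‖) ^ 2) boundary
      (𝓝 (1 - (1 - ‖α‖ ^ 2) * (1 - 1 ^ 2) / (1 - ‖α‖) ^ 2)) :=
    tendsto_const_nhds.sub (((tendsto_const_nhds.mul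
      (tendsto_const_nhds.sub (tendsto_norm_boundary.pow 2)))).div_const _)
  simpa using this

/-! ### Basic properties of finite Blaschke products -/

theorem isBlaschke_iff {n : ℕ} {B : ℂ → ℂ} : IsBlaschke n B ↔
    0 < n ∧ ∃ (c : ℂ) (α : Fin n → ℂ), ‖c‖ = 1 ∧ (∀ k, α k ∈ disk) ∧
      EqOn B (fun z => c * ∏ k, blaschkeFactor (α k) z) disk := by
  simp only [IsBlaschke, mem_disk, EqOn, blaschkeFactor]

theorem isBlaschke_one_iff {B : ℂ → ℂ} : IsBlaschke 1 B ↔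
    ∃ c α : ℂ, ‖c‖ = 1 ∧ α ∈ disk ∧ EqOn B (fun z => c * blaschkeFactor α z) disk := by
  rw [isBlaschke_iff]
  constructor
  · rintro ⟨-, c, α, hc, hα, h⟩
    exact ⟨c, α 0, hc, hα 0, by simpa using h⟩
  · rintro ⟨c, α, hc, hα, h⟩
    exact ⟨one_pos, c, fun _ => α, hc, fun _ => hα, by simpa using h⟩

theorem isBlaschke_blaschkeFactor {α : ℂ} (hα : α ∈ disk) : IsBlaschke 1 (blaschkeFactor α) :=
  isBlaschke_one_iff.2 ⟨1, α, by simp, hα, fun z _ => by simp⟩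

section
variable {n : ℕ} {B : ℂ → ℂ}

theorem IsBlaschke.congr {B' : ℂ → ℂ} (hB : IsBlaschke n B) (h : EqOn B' B disk) :
    IsBlaschke n B' := by
  rw [isBlaschke_iff] at hB ⊢
  obtain ⟨hn, c, α, hc, hα, h'⟩ := hB
  exact ⟨hn, c, α, hc, hα, h.trans h'⟩

theorem IsBlaschke.analyticOnNhd (hB : IsBlaschke n B) : AnalyticOnNhd ℂ B disk := by
  obtain ⟨hn, c, α, hc, hα, h⟩ := isBlaschke_iff.1 hB
  refine AnalyticOnNhd.congr isOpen_disk ?_ h.symm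
  have : AnalyticOnNhd ℂ (∏ k, blaschkeFactor (α k)) disk :=
    Finset.analyticOnNhd_prod _ fun k _ => analyticOnNhd_blaschkeFactor (hα k)
  intro z hz
  have := (analyticAt_const (v := c)).mul (this z hz)
  exact this.congr (Eventually.of_forall fun w => by simp)

theorem IsBlaschke.mapsTo (hB : IsBlaschke n B) : MapsTo B disk disk := by
  obtain ⟨hn, c, α, hc, hα, h⟩ := isBlaschke_iff.1 hB
  intro z hz
  rw [mem_disk, h hz]
  simp only [norm_mul, hc, one_mul, norm_prod]
  have : (Finset.univ : Finset (Fin n)).Nonempty := ⟨⟨0, hn⟩, Finset.mem_univ _⟩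
  by_cases h0 : ∃ k, blaschkeFactor (α k) z = 0
  · obtain ⟨k, hk⟩ := h0
    rw [Finset.prod_eq_zero (Finset.mem_univ k) (by simp [hk])]
    exact one_pos
  · push Not at h0
    calc _ < ∏ k : Fin n, (1 : ℝ) :=
          Finset.prod_lt_prod_of_nonempty (fun k _ => norm_pos_iff.2 (h0 k))
            (fun k _ => mem_disk.1 (blaschkeFactor_mem_disk (hα k) hz)) this
      _ = 1 := by simp

theorem IsBlaschke.tendsto_norm (hB : IsBlaschke n B) :
    Tendsto (fun z => ‖B z‖) boundary (𝓝 1) := by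
  obtain ⟨hn, c, α, hc, hα, h⟩ := isBlaschke_iff.1 hB
  have : Tendsto (fun z => ∏ k, ‖blaschkeFactor (α k) z‖) boundary (𝓝 (∏ k : Fin n, 1)) :=
    tendsto_finsetProd _ fun k _ => tendsto_norm_blaschkeFactor (hα k)
  rw [Finset.prod_const_one] at this
  refine this.congr' ?_
  filter_upwards [eventually_boundary_mem_disk] with z hz
  rw [h hz]
  simp [hc]

theorem IsBlaschke.tendsto_boundary (hB : IsBlaschke n B) : Tendsto B boundary boundary :=
  (tendsto_boundary_iff (eventually_boundary_mem_disk.mono fun _ h => hB.mapsTo h)).2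
    hB.tendsto_norm

end

/-! ### Recognizing finite Blaschke products by their boundary modulus -/

theorem norm_le_one_of_tendsto_boundary {f : ℂ → ℂ} (hf : AnalyticOnNhd ℂ f disk)
    (hb : Tendsto (fun z => ‖f z‖) boundary (𝓝 1)) {z : ℂ} (hz : z ∈ disk) : ‖f z‖ ≤ 1 := by
  refine le_of_forall_pos_le_add fun ε hε => ?_
  obtain ⟨r, hr, hr0, h⟩ := eventually_boundary_iff.1
    (hb.eventually (gt_mem_nhds (lt_add_of_pos_right 1 hε)))
  obtain ⟨s, hs, hs1⟩ := exists_between (max_lt hr (mem_disk.1 hz))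
  have hs0 : 0 < s := hr0.trans ((le_max_left _ _).trans_lt hs)
  have hcl : Metric.closedBall (0 : ℂ) s ⊆ disk := Metric.closedBall_subset_ball hs1
  refine Complex.norm_le_of_forall_mem_frontier_norm_le (U := Metric.ball 0 s)
    Metric.isBounded_ball ?_ ?_ ?_
  · refine (hf.mono hcl).differentiableOn.diffContOnCl_ball subset_rfl
  · intro w hw
    rw [frontier_ball _ hs0.ne'] at hw
    refine (h w (hcl (Metric.sphere_subset_closedBall hw)) ?_).le
    rw [mem_sphere_zero_iff_norm.1 hw]
    exact (le_max_left _ _).trans_lt hs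
  · apply subset_closure
    simpa using (le_max_right _ _).trans_lt hs

/-- The maximum principle for both `f` and `1 / f` forces `|f| = 1` throughout. -/
theorem exists_eqOn_const_of_ne_zero {f : ℂ → ℂ} (hf : AnalyticOnNhd ℂ f disk)
    (hb : Tendsto (fun z => ‖f z‖) boundary (𝓝 1)) (h0 : ∀ z ∈ disk, f z ≠ 0) :
    ∃ c : ℂ, ‖c‖ = 1 ∧ EqOn f (fun _ => c) disk := by
  have h1 : ∀ z ∈ disk, ‖f z‖ = 1 := by
    intro z hz
    refine le_antisymm (norm_le_one_of_tendsto_boundary hf hb hz) ?_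
    have hb' : Tendsto (fun z => ‖(fun z => (f z)⁻¹) z‖) boundary (𝓝 1) := by
      simpa using hb.inv₀ one_ne_zero
    have := norm_le_one_of_tendsto_boundary (f := fun z => (f z)⁻¹) (fun z hz => (hf z hz).inv (h0 z hz)) hb' hz
    rw [norm_inv] at this
    exact (inv_le_one₀ (norm_pos_iff.2 (h0 z hz))).1 this
  refine ⟨f 0, h1 0 zero_mem_disk, ?_⟩
  refine Complex.eqOn_of_isPreconnected_of_isMaxOn_norm isPreconnected_disk isOpen_disk
    hf.differentiableOn zero_mem_disk ?_
  intro z hz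
  simp [h1 z hz, h1 0 zero_mem_disk]

/-- Dividing out a zero. -/
theorem exists_eqOn_blaschkeFactor_mul {f : ℂ → ℂ} (hf : AnalyticOnNhd ℂ f disk)
    (hb : Tendsto (fun z => ‖f z‖) boundary (𝓝 1)) {α : ℂ} (hα : α ∈ disk) (h0 : f α = 0) :
    ∃ g : ℂ → ℂ, AnalyticOnNhd ℂ g disk ∧ Tendsto (fun z => ‖g z‖) boundary (𝓝 1) ∧
      EqOn f (fun z => blaschkeFactor α z * g z) disk := by
  have heq : EqOn f (fun z => blaschkeFactor α z *
      ((1 - (starRingEnd ℂ) α * z) * dslope f α z)) disk := by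
    intro z hz
    have h := one_sub_conj_mul_ne_zero (mem_disk.1 hα) (mem_disk.1 hz).le
    have h2 := sub_smul_dslope f α z
    simp only [smul_eq_mul, h0, sub_zero] at h2
    simp only [blaschkeFactor]
    rw [← h2, ← mul_assoc, div_mul_cancel₀ _ h]
  refine ⟨fun z => (1 - (starRingEnd ℂ) α * z) * dslope f α z, ?_, ?_, heq⟩
  · have hd : DifferentiableOn ℂ (dslope f α) disk :=
      (Complex.differentiableOn_dslope (isOpen_disk.mem_nhds hα)).2 hf.differentiableOn
    exact DifferentiableOn.analyticOnNhd (by fun_prop) isOpen_disk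
  · have := hb.div (tendsto_norm_blaschkeFactor hα) one_ne_zero
    rw [div_one] at this
    refine this.congr' ?_
    filter_upwards [eventually_boundary_mem_disk,
      eventually_boundary_lt_norm (mem_disk.1 hα)] with z hz hz'
    have hne : blaschkeFactor α z ≠ 0 := by
      rw [Ne, blaschkeFactor_eq_zero_iff hα hz]
      rintro rfl
      exact lt_irrefl _ hz'
    simp only [Pi.div_apply]
    rw [heq hz, norm_mul, mul_div_cancel_left₀ _ (norm_ne_zero_iff.2 hne)]

/-- An analytic function on the disk whose modulus tends to `1` at the boundary is a finite
Blaschke product, unless it is a unimodular constant. -/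
theorem exists_isBlaschke {f : ℂ → ℂ} (hf : AnalyticOnNhd ℂ f disk)
    (hb : Tendsto (fun z => ‖f z‖) boundary (𝓝 1)) (h1 : ∃ z ∈ disk, ‖f z‖ < 1) :
    ∃ m, IsBlaschke m f := by
  obtain ⟨z₁, hz₁, hfz₁⟩ := h1
  -- Zeros are divided out one at a time. Either some quotient is zero-free, hence constant, or
  -- arbitrarily many factors split off.
  have key : ∀ N : ℕ, (∃ m, IsBlaschke m f) ∨ ∃ (α : Fin N → ℂ) (g : ℂ → ℂ),
      (∀ k, α k ∈ disk ∧ f (α k) = 0) ∧ AnalyticOnNhd ℂ g disk ∧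
      Tendsto (fun z => ‖g z‖) boundary (𝓝 1) ∧
      EqOn f (fun z => (∏ k, blaschkeFactor (α k) z) * g z) disk := by
    intro N
    induction N with
    | zero => exact Or.inr ⟨Fin.elim0, f, fun k => k.elim0, hf, hb, fun z _ => by simp⟩
    | succ N ih =>
      rcases ih with h | ⟨α, g, hα, hg, hgb, heq⟩
      · exact Or.inl h
      by_cases h0 : ∃ z ∈ disk, g z = 0
      · obtain ⟨β, hβ, hgβ⟩ := h0
        obtain ⟨g', hg', hgb', heq'⟩ := exists_eqOn_blaschkeFactor_mul hg hgb hβ hgβ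
        refine Or.inr ⟨Fin.cons β α, g', ?_, hg', hgb', ?_⟩
        · intro k
          refine Fin.cases ?_ (fun k => ?_) k
          · exact ⟨hβ, by simp [heq hβ, hgβ]⟩
          · exact hα k
        · intro z hz
          rw [heq hz]
          simp only [Fin.prod_univ_succ, Fin.cons_zero, Fin.cons_succ]
          rw [heq' hz]
          ring
      · push Not at h0
        obtain ⟨c, hc, hgc⟩ := exists_eqOn_const_of_ne_zero hg hgb h0
        refine Or.inl ⟨N, isBlaschke_iff.2 ⟨?_, c, α, hc, fun k => (hα k).1, ?_⟩⟩
        · by_contra hN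
          obtain rfl : N = 0 := by omega
          have := heq hz₁
          simp only [Finset.univ_eq_empty, Finset.prod_empty, one_mul] at this
          rw [this, hgc hz₁, hc] at hfz₁
          exact lt_irrefl _ hfz₁
        · intro z hz
          rw [heq hz]
          simp only
          rw [hgc hz]
          ring
  -- The second case is impossible: all zeros lie in a compact disk `|α| ≤ s`, so at a point `z₂`
  -- outside it every factor has modulus at most some `q < 1`, and `|f z₂| ≤ q ^ N` fails for large
  -- `N`.
  have hb' : ∀ᶠ z in boundary, f z ≠ 0 := by
    filter_upwards [hb.eventually (lt_mem_nhds one_pos)] with z hz using norm_pos_iff.1 hz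
  obtain ⟨s, hs, hs0, hs'⟩ := eventually_boundary_iff.1 hb'
  obtain ⟨z₂, hz₂s, hz₂⟩ : ∃ z₂ : ℂ, s < ‖z₂‖ ∧ z₂ ∈ disk := by
    obtain ⟨t, ht, ht1⟩ := exists_between hs
    exact ⟨t, by simpa [abs_of_pos (hs0.trans ht)] using ht,
      mem_disk.2 (by simpa [abs_of_pos (hs0.trans ht)] using ht1)⟩
  have hcont : ContinuousOn (fun α => ‖blaschkeFactor α z₂‖) (Metric.closedBall 0 s) := by
    refine ContinuousOn.norm ?_
    unfold blaschkeFactor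
    refine ContinuousOn.div (by fun_prop) (Continuous.continuousOn
      (continuous_const.sub (Complex.continuous_conj.mul continuous_const))) ?_
    intro α hα
    exact one_sub_conj_mul_ne_zero ((mem_closedBall_zero_iff.1 hα).trans_lt hs)
      (mem_disk.1 hz₂).le
  obtain ⟨β, hβ, hmax⟩ := (isCompact_closedBall (0 : ℂ) s).exists_isMaxOn
    ⟨0, by simp [hs0.le]⟩ hcont
  have hq1 : ‖blaschkeFactor β z₂‖ < 1 :=
    norm_blaschkeFactor_lt_one ((mem_closedBall_zero_iff.1 hβ).trans_lt hs) (mem_disk.1 hz₂)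
  have hpos : 0 < ‖f z₂‖ := norm_pos_iff.2 (hs' z₂ hz₂ hz₂s)
  obtain ⟨N, hN⟩ := exists_pow_lt_of_lt_one hpos hq1
  rcases key N with h | ⟨α, g, hα, hg, hgb, heq⟩
  · exact h
  exfalso
  have hle : ‖f z₂‖ ≤ ‖blaschkeFactor β z₂‖ ^ N := by
    rw [heq hz₂, norm_mul, norm_prod]
    have h1 : ∏ k : Fin N, ‖blaschkeFactor (α k) z₂‖ ≤ ‖blaschkeFactor β z₂‖ ^ N := by
      calc _ ≤ ∏ k : Fin N, ‖blaschkeFactor β z₂‖ := by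
            refine Finset.prod_le_prod (fun k _ => norm_nonneg _) fun k _ => hmax ?_
            rw [mem_closedBall_zero_iff]
            by_contra hk
            exact hs' _ (hα k).1 (not_le.1 hk) (hα k).2
        _ = _ := by simp
    have h2 := norm_le_one_of_tendsto_boundary hg hgb hz₂
    calc _ ≤ ‖blaschkeFactor β z₂‖ ^ N * 1 := by gcongr
      _ = _ := mul_one _
  exact absurd hN (not_lt.2 hle)

/-! ### Fibers as roots of polynomials -/

open Polynomial in
/-- The polynomials whose roots are the points over `v` of a finite Blaschke product. -/
theorem IsBlaschke.exists_fiberPolynomial {n : ℕ} {B : ℂ → ℂ} (hB : IsBlaschke n B) :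
    ∃ (R : ℂ → ℂ[X]) (φ : ℂ → ℂ) (D : ℂ[X]), IsBlaschke 1 φ ∧
      (∀ z ∈ disk, deriv B z = 0 ↔ D.IsRoot z) ∧
      ∀ v ∈ disk, (R v).natDegree = n ∧ (R v).coeff 0 = (-1) ^ n * (R v).leadingCoeff * φ v ∧
        (∀ z, (R v).IsRoot z ↔ z ∈ disk ∧ B z = v) ∧
        (∀ z ∈ disk, B z = v → ((R v).derivative.IsRoot z ↔ deriv B z = 0)) := by
  obtain ⟨hn, c, α, hc, hα, heq⟩ := isBlaschke_iff.1 hB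
  have hc0 : c ≠ 0 := norm_ne_zero_iff.1 (by rw [hc]; exact one_ne_zero)
  set P : ℂ[X] := C c * ∏ k, (X - C (α k)) with hP
  set Q : ℂ[X] := ∏ k, (C (-(starRingEnd ℂ) (α k)) * X + C 1) with hQ
  set A : ℂ := ∏ k, α k with hA
  have hPe : ∀ z, P.eval z = c * ∏ k, (z - α k) := by simp [hP, eval_prod]
  have hQe : ∀ z, Q.eval z = ∏ k, (1 - (starRingEnd ℂ) (α k) * z) := by
    intro z
    rw [hQ, eval_prod]
    refine Finset.prod_congr rfl fun k _ => ?_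
    simp
    ring
  have hQ0 : ∀ z ∈ disk, Q.eval z ≠ 0 := by
    intro z hz
    rw [hQe]
    exact Finset.prod_ne_zero_iff.2 fun k _ =>
      one_sub_conj_mul_ne_zero (mem_disk.1 (hα k)) (mem_disk.1 hz).le
  have hBe : ∀ z ∈ disk, B z = P.eval z / Q.eval z := by
    intro z hz
    rw [heq hz, hPe, hQe]
    simp only [blaschkeFactor, Finset.prod_div_distrib, mul_div_assoc]
  have hderiv : ∀ z ∈ disk, deriv B z =
      (P.derivative.eval z * Q.eval z - P.eval z * Q.derivative.eval z) / Q.eval z ^ 2 := by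
    intro z hz
    have h1 : B =ᶠ[𝓝 z] fun z => P.eval z / Q.eval z := by
      filter_upwards [isOpen_disk.mem_nhds hz] with w hw using hBe w hw
    rw [h1.deriv_eq]
    exact ((P.hasDerivAt z).fun_div (Q.hasDerivAt z) (hQ0 z hz)).deriv
  have hPn : P.natDegree ≤ n := by
    refine (natDegree_C_mul_le _ _).trans ((natDegree_prod_le _ _).trans ?_)
    simp
  have hQn : Q.natDegree ≤ n := by
    refine (natDegree_prod_le _ _).trans ?_
    refine (Finset.sum_le_sum fun k _ => natDegree_linear_le).trans ?_
    simp
  have hPc : P.coeff n = c := by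
    have := coeff_prod_of_natDegree_le (Finset.univ : Finset (Fin n)) (fun k => X - C (α k)) 1
      (fun k _ => natDegree_X_sub_C_le _)
    simp only [Finset.card_univ, Fintype.card_fin, mul_one] at this
    rw [hP, coeff_C_mul, this]
    simp [coeff_X]
  have hQc : Q.coeff n = (-1) ^ n * (starRingEnd ℂ) A := by
    have := coeff_prod_of_natDegree_le (Finset.univ : Finset (Fin n))
      (fun k => C (-(starRingEnd ℂ) (α k)) * X + C 1) 1 (fun k _ => natDegree_linear_le)
    simp only [Finset.card_univ, Fintype.card_fin, mul_one] at this
    rw [hQ, this, hA, map_prod]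
    simp [coeff_one, Finset.prod_neg]
  have hP0 : P.coeff 0 = c * ((-1) ^ n * A) := by
    rw [coeff_zero_eq_eval_zero, hPe, hA]
    simp [Finset.prod_neg]
  have hQ00 : Q.coeff 0 = 1 := by
    rw [coeff_zero_eq_eval_zero, hQe]
    simp
  clear_value P Q A
  have hAn : ‖A‖ < 1 := by
    have : B 0 ∈ disk := hB.mapsTo zero_mem_disk
    rw [mem_disk, hBe 0 zero_mem_disk, ← coeff_zero_eq_eval_zero, ← coeff_zero_eq_eval_zero,
      hP0, hQ00] at this
    simpa [hc] using this
  set a : ℂ := c * ((-1) ^ n * A) with ha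
  have han : a ∈ disk := mem_disk.2 (by simpa [ha, hc] using hAn)
  have hcc : (starRingEnd ℂ) c * c = 1 := by
    rw [mul_comm, Complex.mul_conj, Complex.normSq_eq_norm_sq, hc]
    simp
  -- With `B = P / Q`, the fiber over `v` is the root set of `P - v Q`. Its constant coefficient is
  -- `a - v` with `a = B 0`, and its leading coefficient is `c (1 - conj a * v)`; their quotient is
  -- an automorphism of the disk in `v`.
  refine ⟨fun v => P - C v * Q, fun v => (-1) ^ (n + 1) * (starRingEnd ℂ) c * blaschkeFactor a v,
    P.derivative * Q - P * Q.derivative, ?_, ?_, ?_⟩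
  · exact isBlaschke_one_iff.2 ⟨_, a, by simp [hc], han, fun z _ => rfl⟩
  · intro z hz
    rw [hderiv z hz, div_eq_zero_iff, or_iff_left (pow_ne_zero 2 (hQ0 z hz))]
    simp [IsRoot]
  · intro v hv
    have hlead : c - v * ((-1) ^ n * (starRingEnd ℂ) A) = c * (1 - (starRingEnd ℂ) a * v) := by
      simp only [ha, map_mul, map_pow, map_neg, map_one]
      linear_combination (v * (-1) ^ n * (starRingEnd ℂ) A) * hcc
    have hlead0 := one_sub_conj_mul_ne_zero (mem_disk.1 han) (mem_disk.1 hv).le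
    have hcoeff : (P - C v * Q).coeff n = c * (1 - (starRingEnd ℂ) a * v) := by
      rw [coeff_sub, coeff_C_mul, hPc, hQc, hlead]
    have hdeg : (P - C v * Q).natDegree = n := by
      refine natDegree_eq_of_le_of_coeff_ne_zero ?_ ?_
      · exact (natDegree_sub_le _ _).trans (max_le hPn ((natDegree_C_mul_le _ _).trans hQn))
      · rw [hcoeff]
        exact mul_ne_zero hc0 hlead0
    refine ⟨hdeg, ?_, ?_, ?_⟩
    · rw [leadingCoeff, hdeg, hcoeff, coeff_sub, coeff_C_mul, hP0, hQ00]
      simp only [blaschkeFactor]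
      have h2 : ((-1 : ℂ) ^ n) * (-1) ^ n = 1 := by rw [← mul_pow]; simp
      calc a - v * 1 = - (v - a) := by ring
        _ = - (((-1) ^ n * (-1) ^ n) * ((starRingEnd ℂ) c * c) * (v - a)) := by rw [h2, hcc]; ring
        _ = (-1) ^ n * (c * (1 - (starRingEnd ℂ) a * v)) *
            ((-1) ^ (n + 1) * (starRingEnd ℂ) c * ((v - a) / (1 - (starRingEnd ℂ) a * v))) := by
          have hX := div_mul_cancel₀ (v - a) hlead0
          generalize (v - a) / (1 - (starRingEnd ℂ) a * v) = X at hX ⊢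
          linear_combination ((-1) ^ n * (-1) ^ n * ((starRingEnd ℂ) c * c)) * hX
    · intro z
      simp only [IsRoot, eval_sub, eval_mul, eval_C]
      constructor
      · intro h
        have hz : z ∈ disk := by
          -- Outside the disk `|Q| ≤ |P| = |v| |Q|` with `|v| < 1` forces `P z = 0`, but the zeros
          -- of `P` are the `α k`.
          by_contra hz
          rw [mem_disk, not_lt] at hz
          have h1 : ‖Q.eval z‖ ≤ ‖P.eval z‖ := by
            rw [hPe, hQe, norm_mul, hc, one_mul, norm_prod, norm_prod]
            refine Finset.prod_le_prod (fun k _ => norm_nonneg _) fun k _ => ?_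
            have h2 := normSq_one_sub_conj_mul_sub (α k) z
            have h3 : 0 ≤ 1 - ‖α k‖ ^ 2 := by
              nlinarith [norm_nonneg (α k), mem_disk.1 (hα k)]
            have h4 : 0 ≤ ‖z‖ ^ 2 - 1 := by nlinarith
            refine le_of_sq_le_sq ?_ (norm_nonneg _)
            nlinarith [mul_nonneg h3 h4]
          have h2 : ‖P.eval z‖ = ‖v‖ * ‖Q.eval z‖ := by rw [sub_eq_zero.1 h, norm_mul]
          have h3 : P.eval z = 0 := by
            rw [← norm_eq_zero]
            nlinarith [norm_nonneg (P.eval z), norm_nonneg (Q.eval z), mem_disk.1 hv, norm_nonneg v]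
          rw [hPe, mul_eq_zero, or_iff_right hc0, Finset.prod_eq_zero_iff] at h3
          obtain ⟨k, -, hk⟩ := h3
          rw [sub_eq_zero.1 hk] at hz
          exact absurd (mem_disk.1 (hα k)) (not_lt.2 hz)
        refine ⟨hz, ?_⟩
        rw [hBe z hz, div_eq_iff (hQ0 z hz)]
        exact sub_eq_zero.1 h
      · rintro ⟨hz, h⟩
        rw [hBe z hz, div_eq_iff (hQ0 z hz)] at h
        rw [h, sub_self]
    · intro z hz h
      rw [hderiv z hz, div_eq_zero_iff, or_iff_left (pow_ne_zero 2 (hQ0 z hz))]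
      rw [hBe z hz, div_eq_iff (hQ0 z hz)] at h
      have : P.derivative.eval z * Q.eval z - P.eval z * Q.derivative.eval z =
          (P - C v * Q).derivative.eval z * Q.eval z := by
        rw [h]
        simp
        ring
      rw [this, mul_eq_zero, or_iff_left (hQ0 z hz)]
      rfl

section
variable {n : ℕ} {B : ℂ → ℂ}

theorem IsBlaschke.card_le_of_fiber (hB : IsBlaschke n B) {v : ℂ} (hv : v ∈ disk)
    {S : Finset ℂ} (hS : ∀ z ∈ S, z ∈ disk ∧ B z = v) : S.card ≤ n := by
  obtain ⟨R, φ, D, -, -, h⟩ := hB.exists_fiberPolynomial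
  obtain ⟨hdeg, -, hroot, -⟩ := h v hv
  rw [← hdeg]
  refine Polynomial.card_le_degree_of_subset_roots fun z hz => ?_
  rw [Polynomial.mem_roots]
  · exact (hroot z).2 (hS z hz)
  · rintro h0
    rw [h0, Polynomial.natDegree_zero] at hdeg
    exact hB.1.ne hdeg

/-- Vieta's formula: `n` distinct points of a fiber are all the roots of a polynomial of degree `n`.
This links orbit products to right factors. -/
theorem IsBlaschke.exists_prod_fiber_eq (hB : IsBlaschke n B) :
    ∃ φ : ℂ → ℂ, IsBlaschke 1 φ ∧ ∀ v ∈ disk, ∀ S : Finset ℂ, (∀ z ∈ S, z ∈ disk ∧ B z = v) →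
      S.card = n → ∏ z ∈ S, z = φ v := by
  obtain ⟨R, φ, D, hφ, -, h⟩ := hB.exists_fiberPolynomial
  refine ⟨φ, hφ, fun v hv S hS hcard => ?_⟩
  obtain ⟨hdeg, hcoeff, hroot, -⟩ := h v hv
  have h0 : R v ≠ 0 := by
    rintro h0
    rw [h0, Polynomial.natDegree_zero] at hdeg
    exact hB.1.ne hdeg
  have hsub : S.val ≤ (R v).roots := Finset.val_le_iff_val_subset.2 fun z hz =>
    (Polynomial.mem_roots h0).2 ((hroot z).2 (hS z hz))
  have heq : S.val = (R v).roots :=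
    Multiset.eq_of_le_of_card_le hsub (by
      rw [Finset.card_val, hcard, ← hdeg]
      exact Polynomial.card_roots' _)
  have h1 := (IsAlgClosed.splits (R v)).coeff_zero_eq_leadingCoeff_mul_prod_roots
  rw [hcoeff, hdeg, ← heq] at h1
  have h2 : (-1) ^ n * (R v).leadingCoeff ≠ 0 := by simp [h0]
  have h3 := mul_left_cancel₀ h2 h1
  rw [h3, Finset.prod_val]
  rfl

theorem IsBlaschke.exists_fiber (hB : IsBlaschke n B) {v : ℂ} (hv : v ∈ disk)
    (hc : v ∉ criticalValues B) :
    ∃ S : Finset ℂ, S.card = n ∧ ∀ z, z ∈ S ↔ z ∈ disk ∧ B z = v := by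
  obtain ⟨R, φ, D, -, -, h⟩ := hB.exists_fiberPolynomial
  obtain ⟨hdeg, -, hroot, hder⟩ := h v hv
  have h0 : R v ≠ 0 := by
    rintro h0
    rw [h0, Polynomial.natDegree_zero] at hdeg
    exact hB.1.ne hdeg
  have hnodup : (R v).roots.Nodup := by
    rw [Multiset.nodup_iff_count_le_one]
    intro z
    rw [Polynomial.count_roots]
    by_contra hz
    rw [not_le, Polynomial.one_lt_rootMultiplicity_iff_isRoot h0] at hz
    obtain ⟨hz1, hz2⟩ := (hroot z).1 hz.1
    exact hc ⟨z, hz1, (hder z hz1 hz2).1 hz.2, hz2⟩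
  refine ⟨⟨_, hnodup⟩, ?_, fun z => ?_⟩
  · rw [Finset.card_mk, ← hdeg]
    exact (Polynomial.splits_iff_card_roots.1 (IsAlgClosed.splits (R v)))
  · rw [Finset.mem_mk, Polynomial.mem_roots h0, hroot]

theorem IsBlaschke.surjOn (hB : IsBlaschke n B) : SurjOn B disk disk := by
  intro v hv
  obtain ⟨R, φ, D, -, -, h⟩ := hB.exists_fiberPolynomial
  obtain ⟨hdeg, -, hroot, hder⟩ := h v hv
  obtain ⟨z, hz⟩ := IsAlgClosed.exists_root (R v) (by
    intro h0
    have := Polynomial.natDegree_eq_of_degree_eq_some h0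
    rw [hdeg] at this
    exact hB.1.ne' this)
  exact ⟨z, (hroot z).1 hz⟩

theorem IsBlaschke.finite_fiber (hB : IsBlaschke n B) {v : ℂ} (hv : v ∈ disk) :
    {z | z ∈ disk ∧ B z = v}.Finite := by
  by_contra hinf
  obtain ⟨S, hS, hcard⟩ := Set.Infinite.exists_subset_card_eq hinf (n + 1)
  have := hB.card_le_of_fiber hv (S := S) fun z hz => hS hz
  omega

theorem IsBlaschke.not_const (hB : IsBlaschke n B) (w : ℂ) : ¬ ∀ z ∈ disk, B z = w := by
  intro h
  obtain ⟨z, hz, h1⟩ := hB.surjOn zero_mem_disk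
  obtain ⟨z', hz', h2⟩ := hB.surjOn (show (1 / 2 : ℂ) ∈ disk by rw [mem_disk]; norm_num)
  rw [h z hz] at h1
  rw [h z' hz', h1] at h2
  norm_num at h2

theorem IsBlaschke.finite_criticalPoints (hB : IsBlaschke n B) :
    {z | z ∈ disk ∧ deriv B z = 0}.Finite := by
  obtain ⟨R, φ, D, -, hD, -⟩ := hB.exists_fiberPolynomial
  have h0 : D ≠ 0 := by
    rintro rfl
    have : ∀ z ∈ disk, deriv B z = 0 := fun z hz => (hD z hz).2 (by simp)
    refine hB.not_const (B 0) fun z hz => ?_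
    exact IsOpen.is_const_of_deriv_eq_zero isOpen_disk isPreconnected_disk
      hB.analyticOnNhd.differentiableOn (fun z hz => this z hz) hz zero_mem_disk
  refine (D.roots.toFinset.finite_toSet).subset ?_
  rintro z ⟨hz, hz'⟩
  simpa [h0] using (hD z hz).1 hz'

theorem IsBlaschke.finite_criticalValues (hB : IsBlaschke n B) : (criticalValues B).Finite := by
  refine (hB.finite_criticalPoints.image B).subset ?_
  rintro w ⟨z, hz, h, rfl⟩
  exact ⟨z, ⟨hz, h⟩, rfl⟩

theorem IsBlaschke.isOpen_image (hB : IsBlaschke n B) {s : Set ℂ} (hs : IsOpen s)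
    (hsd : s ⊆ disk) : IsOpen (B '' s) := by
  rcases hB.analyticOnNhd.is_constant_or_isOpen isPreconnected_disk with ⟨w, h⟩ | h
  · exact absurd h (hB.not_const w)
  · exact h s hsd hs

/-- A right inverse near a noncritical point. -/
theorem exists_localInverse {f : ℂ → ℂ} {z : ℂ} (hf : AnalyticAt ℂ f z) (hz : deriv f z ≠ 0) :
    ∃ s : ℂ → ℂ, AnalyticAt ℂ s (f z) ∧ s (f z) = z ∧ (∀ᶠ w in 𝓝 (f z), f (s w) = w) ∧
      ∀ᶠ y in 𝓝 z, s (f y) = y :=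
  ⟨_, hf.analyticAt_localInverse hz, HasStrictFDerivAt.localInverse_apply_image ..,
    HasStrictDerivAt.eventually_right_inverse .., HasStrictDerivAt.eventually_left_inverse ..⟩

/-- Chain rule; the first part also needs that `b` maps onto the disk. -/
theorem IsBlaschke.criticalValues_comp_left {m : ℕ} {J b : ℂ → ℂ} (hJ : IsBlaschke m J)
    (hb : IsBlaschke n b) {I : ℂ → ℂ} (h : EqOn I (J ∘ b) disk) :
    criticalValues J ⊆ criticalValues I ∧
      ∀ z ∈ disk, deriv b z = 0 → I z ∈ criticalValues I := by
  have hd : ∀ z ∈ disk, deriv I z = deriv J (b z) * deriv b z := by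
    intro z hz
    have h1 : I =ᶠ[𝓝 z] J ∘ b := by
      filter_upwards [isOpen_disk.mem_nhds hz] with w hw using h hw
    rw [h1.deriv_eq]
    exact deriv_comp z (hJ.analyticOnNhd _ (hb.mapsTo hz)).differentiableAt
      (hb.analyticOnNhd z hz).differentiableAt
  constructor
  · rintro w ⟨y, hy, hy', rfl⟩
    obtain ⟨z, hz, rfl⟩ := hb.surjOn hy
    exact ⟨z, hz, by rw [hd z hz, hy', zero_mul], h hz⟩
  · intro z hz hz'
    exact ⟨z, hz, by rw [hd z hz, hz', mul_zero], rfl⟩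

end

/-! ### Blaschke products of order one -/

theorem norm_conj_mul_self {c : ℂ} (hc : ‖c‖ = 1) : (starRingEnd ℂ) c * c = 1 := by
  rw [mul_comm, Complex.mul_conj, Complex.normSq_eq_norm_sq, hc]
  simp

theorem IsBlaschke.exists_inverse {φ : ℂ → ℂ} (hφ : IsBlaschke 1 φ) :
    ∃ ψ : ℂ → ℂ, IsBlaschke 1 ψ ∧ (∀ z ∈ disk, ψ (φ z) = z) ∧ ∀ z ∈ disk, φ (ψ z) = z := by
  obtain ⟨c, α, hc, hα, h⟩ := isBlaschke_one_iff.1 hφ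
  have hcc := norm_conj_mul_self hc
  have hc0 : c ≠ 0 := norm_ne_zero_iff.1 (by rw [hc]; exact one_ne_zero)
  have hβ : -(c * α) ∈ disk := by
    rw [mem_disk, norm_neg, norm_mul, hc, one_mul]
    exact mem_disk.1 hα
  set ψ : ℂ → ℂ := fun w => (starRingEnd ℂ) c * blaschkeFactor (-(c * α)) w with hψ
  have hψB : IsBlaschke 1 ψ := isBlaschke_one_iff.2 ⟨_, _, by simpa using hc, hβ, fun z _ => rfl⟩
  have hleft : ∀ z ∈ disk, ψ (φ z) = z := by
    intro z hz
    have h1 := one_sub_conj_mul_ne_zero (mem_disk.1 hα) (mem_disk.1 hz).le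
    have h2 := one_sub_conj_mul_ne_zero (mem_disk.1 hβ) (mem_disk.1 (hφ.mapsTo hz)).le
    simp only [hψ, blaschkeFactor]
    rw [← mul_div_assoc, div_eq_iff h2, h hz]
    have hF : blaschkeFactor α z * (1 - (starRingEnd ℂ) α * z) = z - α := div_mul_cancel₀ _ h1
    simp only [map_neg, map_mul]
    linear_combination hF + (blaschkeFactor α z + α - z * (starRingEnd ℂ) α * blaschkeFactor α z) * hcc
  refine ⟨ψ, hψB, hleft, fun w hw => ?_⟩
  obtain ⟨z, hz, rfl⟩ := hφ.surjOn hw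
  rw [hleft z hz]

theorem IsBlaschke.injOn {φ : ℂ → ℂ} (hφ : IsBlaschke 1 φ) : InjOn φ disk := by
  obtain ⟨ψ, -, h, -⟩ := hφ.exists_inverse
  intro z hz w hw hzw
  rw [← h z hz, hzw, h w hw]

theorem IsBlaschke.comp {m n : ℕ} {J b : ℂ → ℂ} (hJ : IsBlaschke m J) (hb : IsBlaschke n b) :
    ∃ k, IsBlaschke k (J ∘ b) := by
  refine exists_isBlaschke (hJ.analyticOnNhd.comp hb.analyticOnNhd hb.mapsTo)
    (hJ.tendsto_norm.comp hb.tendsto_boundary) ?_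
  exact ⟨0, zero_mem_disk, mem_disk.1 (hJ.mapsTo (hb.mapsTo zero_mem_disk))⟩

/-- The new zero `β` is the preimage of `α` under `φ`. -/
theorem blaschkeFactor_comp {φ : ℂ → ℂ} (hφ : IsBlaschke 1 φ) {α : ℂ} (hα : α ∈ disk) :
    ∃ μ β : ℂ, ‖μ‖ = 1 ∧ β ∈ disk ∧ ∀ z ∈ disk, blaschkeFactor α (φ z) = μ * blaschkeFactor β z := by
  obtain ⟨c, γ, hc, hγ, h⟩ := isBlaschke_one_iff.1 hφ
  have hcc := norm_conj_mul_self hc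
  have hc0 : c ≠ 0 := norm_ne_zero_iff.1 (by rw [hc]; exact one_ne_zero)
  have hδ : -(γ * c) ∈ disk := by
    rw [mem_disk, norm_neg, norm_mul, hc, mul_one]
    exact mem_disk.1 hγ
  have hden : 1 + (starRingEnd ℂ) (γ * c) * α ≠ 0 := by
    have := one_sub_conj_mul_ne_zero (mem_disk.1 hδ) (mem_disk.1 hα).le
    simpa using this
  set d : ℂ := 1 + (starRingEnd ℂ) (γ * c) * α with hd
  have hd0 : (starRingEnd ℂ) d ≠ 0 := by simpa using hden
  have hβ : (starRingEnd ℂ) c * blaschkeFactor (-(γ * c)) α ∈ disk := by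
    rw [mem_disk, norm_mul, RCLike.norm_conj, hc, one_mul]
    exact mem_disk.1 (blaschkeFactor_mem_disk hδ hα)
  refine ⟨c * d / (starRingEnd ℂ) d, _, by simp [hc, hden], hβ, fun z hz => ?_⟩
  have h1 := one_sub_conj_mul_ne_zero (mem_disk.1 hγ) (mem_disk.1 hz).le
  have h2 := one_sub_conj_mul_ne_zero (mem_disk.1 hα) (mem_disk.1 (hφ.mapsTo hz)).le
  have h3 := one_sub_conj_mul_ne_zero (mem_disk.1 hβ) (mem_disk.1 hz).le
  have hβe : (starRingEnd ℂ) c * blaschkeFactor (-(γ * c)) α =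
      ((starRingEnd ℂ) c * α + γ) / d := by
    rw [blaschkeFactor, ← mul_div_assoc]
    congr 1
    · linear_combination γ * hcc
    · rw [hd]; simp
  rw [hβe] at h3 ⊢
  have hcj : (starRingEnd ℂ) (((starRingEnd ℂ) c * α + γ) / d) =
      (c * (starRingEnd ℂ) α + (starRingEnd ℂ) γ) / (starRingEnd ℂ) d := by simp
  have h4 : (starRingEnd ℂ) d - (c * (starRingEnd ℂ) α + (starRingEnd ℂ) γ) * z ≠ 0 := by
    intro h0
    apply h3
    rw [hcj, div_mul_eq_mul_div, sub_eq_zero, eq_comm, div_eq_one_iff_eq hd0]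
    exact (sub_eq_zero.1 h0).symm
  have e1 : φ z = c * (z - γ) / (1 - (starRingEnd ℂ) γ * z) := by
    rw [h hz]; simp only [blaschkeFactor, mul_div_assoc]
  have e2 : blaschkeFactor α (φ z) = (c * (z - γ) - α * (1 - (starRingEnd ℂ) γ * z)) /
      ((1 - (starRingEnd ℂ) γ * z) - (starRingEnd ℂ) α * (c * (z - γ))) := by
    rw [blaschkeFactor, e1]
    rw [← mul_div_mul_right _ _ h1]
    congr 1
    · rw [sub_mul, div_mul_cancel₀ _ h1]
    · rw [sub_mul, one_mul, mul_assoc, div_mul_cancel₀ _ h1]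
  have e3 : blaschkeFactor (((starRingEnd ℂ) c * α + γ) / d) z =
      ((z * d - ((starRingEnd ℂ) c * α + γ)) * (starRingEnd ℂ) d) /
      (((starRingEnd ℂ) d - (c * (starRingEnd ℂ) α + (starRingEnd ℂ) γ) * z) * d) := by
    rw [blaschkeFactor, hcj, div_eq_div_iff (by rwa [hcj] at h3) (mul_ne_zero h4 hden)]
    field_simp
  have hdd : (starRingEnd ℂ) d = 1 + γ * c * (starRingEnd ℂ) α := by simp [hd]
  have e4 : (1 - (starRingEnd ℂ) γ * z) - (starRingEnd ℂ) α * (c * (z - γ)) =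
      (starRingEnd ℂ) d - (c * (starRingEnd ℂ) α + (starRingEnd ℂ) γ) * z := by
    rw [hdd]; ring
  have e5 : c * (z - γ) - α * (1 - (starRingEnd ℂ) γ * z) =
      c * (z * d - ((starRingEnd ℂ) c * α + γ)) := by
    simp only [hd, map_mul]
    linear_combination (α - z * (starRingEnd ℂ) γ * α) * hcc
  rw [e2, e3, e4, e5]
  field_simp

/-- Unlike `IsBlaschke.comp`, this keeps track of the order, which counting points in fibers
requires. -/
theorem IsBlaschke.comp_one {n : ℕ} {B φ : ℂ → ℂ} (hB : IsBlaschke n B) (hφ : IsBlaschke 1 φ) :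
    IsBlaschke n (B ∘ φ) := by
  obtain ⟨hn, c, α, hc, hα, h⟩ := isBlaschke_iff.1 hB
  choose μ β hμ hβ hμβ using fun k => blaschkeFactor_comp hφ (hα k)
  refine isBlaschke_iff.2 ⟨hn, c * ∏ k, μ k, β, by simp [hc, hμ], hβ, fun z hz => ?_⟩
  simp only [Function.comp, h (hφ.mapsTo hz)]
  rw [mul_assoc, ← Finset.prod_mul_distrib]
  congr 1
  exact Finset.prod_congr rfl fun k _ => hμβ k z hz

/-! ### Covering properties and lifting -/

section
variable {n : ℕ} {B : ℂ → ℂ}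

/-- The points of the disk that are not critical values. -/
def regularValues (B : ℂ → ℂ) : Set ℂ := disk \ criticalValues B

theorem deriv_ne_zero_of_mem_regularValues {z : ℂ} (hz : z ∈ disk) (h : B z ∈ regularValues B) :
    deriv B z ≠ 0 := fun h0 => h.2 ⟨z, hz, h0, rfl⟩

theorem IsBlaschke.exists_norm_le (hB : IsBlaschke n B) {r : ℝ} (hr : r < 1) :
    ∃ s < 1, 0 < s ∧ ∀ z ∈ disk, ‖B z‖ ≤ r → ‖z‖ ≤ s := by
  obtain ⟨s, hs, hs0, h⟩ := eventually_boundary_iff.1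
    (hB.tendsto_norm.eventually (lt_mem_nhds hr))
  refine ⟨s, hs, hs0, fun z hz hz' => ?_⟩
  by_contra hlt
  exact absurd (h z hz (not_le.1 hlt)) (not_lt.2 hz')

/-- Points over a thin boundary annulus are themselves close to the circle, since the image of a
compact disk is compact in the disk. -/
theorem IsBlaschke.exists_lt_norm (hB : IsBlaschke n B) {r : ℝ} (hr0 : 0 ≤ r) (hr1 : r < 1) :
    ∃ t < 1, 0 < t ∧ ∀ z ∈ disk, t ≤ ‖B z‖ → r < ‖z‖ := by
  have hcl : Metric.closedBall (0 : ℂ) r ⊆ disk := Metric.closedBall_subset_ball hr1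
  obtain ⟨z₀, hz₀, hmax⟩ := (isCompact_closedBall (0 : ℂ) r).exists_isMaxOn
    ⟨0, by simp [hr0]⟩ (hB.analyticOnNhd.continuousOn.mono hcl).norm
  obtain ⟨t, ht, ht1⟩ := exists_between (mem_disk.1 (hB.mapsTo (hcl hz₀)))
  refine ⟨t, ht1, (norm_nonneg _).trans_lt ht, fun z hz hzt => ?_⟩
  by_contra hzr
  exact absurd (hmax (mem_closedBall_zero_iff.2 (not_lt.1 hzr))) (not_le.2 (ht.trans_le hzt))

theorem IsBlaschke.isProperMap (hB : IsBlaschke n B) : IsProperMap hB.mapsTo.restrict := by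
  have hcont : Continuous (hB.mapsTo.restrict) :=
    hB.analyticOnNhd.continuousOn.mapsToRestrict hB.mapsTo
  have : LocallyCompactSpace disk := isOpen_disk.locallyCompactSpace
  refine isProperMap_iff_isCompact_preimage.2 ⟨hcont, fun K hK => ?_⟩
  obtain ⟨r, hr, hKr⟩ : ∃ r < 1, ∀ w ∈ K, ‖(w : ℂ)‖ ≤ r := by
    rcases K.eq_empty_or_nonempty with rfl | hne
    · exact ⟨0, one_pos, by simp⟩
    · obtain ⟨w, hw, hmax⟩ := hK.exists_isMaxOn hne
        (continuous_norm.comp continuous_subtype_val).continuousOn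
      exact ⟨_, mem_disk.1 w.2, fun w' hw' => hmax hw'⟩
  obtain ⟨s, hs, -, h⟩ := hB.exists_norm_le hr
  have hcl : Metric.closedBall (0 : ℂ) s ⊆ disk := Metric.closedBall_subset_ball hs
  have hcomp : IsCompact ((↑) ⁻¹' Metric.closedBall (0 : ℂ) s : Set disk) := by
    rw [Subtype.isCompact_iff, Subtype.image_preimage_coe, inter_eq_right.2 hcl]
    exact isCompact_closedBall _ _
  refine hcomp.of_isClosed_subset (hK.isClosed.preimage hcont) fun z hz => ?_
  exact mem_closedBall_zero_iff.2 (h z z.2 (hKr _ hz))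

theorem IsBlaschke.eventually_injOn (hB : IsBlaschke n B) {z : ℂ} (hz : z ∈ disk)
    (hd : deriv B z ≠ 0) : ∃ U ∈ 𝓝 z, InjOn B U := by
  obtain ⟨s, -, -, -, h⟩ := exists_localInverse (hB.analyticOnNhd z hz) hd
  exact ⟨_, h, fun y hy y' hy' he => by
    rw [← show s (B y) = y from hy, he]; exact hy'⟩

/-- A closed map with finite fibers that is a local homeomorphism over a set is a covering over it.
-/
theorem IsBlaschke.isCoveringMapOn (hB : IsBlaschke n B) :
    IsCoveringMapOn hB.mapsTo.restrict {w : disk | (w : ℂ) ∉ criticalValues B} := by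
  have hcont : Continuous (hB.mapsTo.restrict) := hB.isProperMap.continuous
  refine hB.isProperMap.isClosedMap.isCoveringMapOn_of_isLocalHomeomorphOn ?_ ?_
  · intro w hw
    have := (hB.finite_fiber w.2).preimage (f := ((↑) : disk → ℂ)) Subtype.val_injective.injOn
    refine this.subset fun z hz => ⟨z.2, ?_⟩
    exact congrArg Subtype.val hz
  · rw [isLocalHomeomorphOn_iff_isOpenEmbedding_restrict]
    intro z hz
    obtain ⟨U, hU, hinj⟩ := hB.eventually_injOn z.2 (deriv_ne_zero_of_mem_regularValues z.2
      ⟨hB.mapsTo z.2, hz⟩)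
    obtain ⟨V, hVU, hV, hzV⟩ := mem_nhds_iff.1 hU
    have hV' : IsOpen ((↑) ⁻¹' V : Set disk) := hV.preimage continuous_subtype_val
    refine ⟨(↑) ⁻¹' V, hV'.mem_nhds hzV, ?_⟩
    refine IsOpenEmbedding.of_continuous_injective_isOpenMap
      (hcont.comp continuous_subtype_val) ?_ ?_
    · rintro ⟨y, hy⟩ ⟨y', hy'⟩ he
      have := hinj (hVU hy) (hVU hy') (congrArg Subtype.val he)
      exact Subtype.ext (Subtype.ext this)
    · refine IsOpenMap.comp ?_ hV'.isOpenMap_subtype_val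
      intro S hS
      have h1 := hB.isOpen_image (isOpen_disk.isOpenMap_subtype_val S hS) (by simp)
      convert h1.preimage continuous_subtype_val using 1
      ext w
      constructor
      · rintro ⟨y, hy, rfl⟩
        exact ⟨y, ⟨y, hy, rfl⟩, rfl⟩
      · rintro ⟨-, ⟨y, hy, rfl⟩, h⟩
        exact ⟨y, hy, Subtype.ext h⟩

theorem IsBlaschke.exists_lift (hB : IsBlaschke n B) {A : Type*} [TopologicalSpace A]
    [SimplyConnectedSpace A] [LocallyPathConnectedSpace A] {γ : A → ℂ} (hγ : Continuous γ)
    (hreg : ∀ a, γ a ∈ regularValues B) {a₀ : A} {z₀ : ℂ} (hz₀ : z₀ ∈ disk) (h₀ : B z₀ = γ a₀) :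
    ∃ Γ : A → ℂ, Continuous Γ ∧ (∀ a, Γ a ∈ disk ∧ B (Γ a) = γ a) ∧ Γ a₀ = z₀ := by
  obtain ⟨F, ⟨hF0, hF⟩, -⟩ := hB.isCoveringMapOn.existsUnique_continuousMap_lifts
    (⟨fun a => ⟨γ a, (hreg a).1⟩, by fun_prop⟩ : C(A, disk)) (a₀ := a₀) (e₀ := ⟨z₀, hz₀⟩)
    (Subtype.ext h₀) (fun a => (hreg a).2)
  refine ⟨fun a => F a, continuous_subtype_val.comp F.continuous, fun a => ⟨(F a).2, ?_⟩, ?_⟩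
  · exact congrArg Subtype.val (congrFun hF a)
  · simp [hF0]

theorem IsBlaschke.lift_unique (hB : IsBlaschke n B) {A : Type*} [TopologicalSpace A]
    [PreconnectedSpace A] {Γ Γ' : A → ℂ} (hΓ : Continuous Γ) (hΓ' : Continuous Γ')
    (hd : ∀ a, Γ a ∈ disk) (heq : ∀ a, B (Γ a) = B (Γ' a))
    (hreg : ∀ a, B (Γ a) ∈ regularValues B) {a₀ : A} (h₀ : Γ a₀ = Γ' a₀) : Γ = Γ' := by
  have hcl : IsClopen {a | Γ a = Γ' a} := by
    refine ⟨isClosed_eq hΓ hΓ', isOpen_iff_mem_nhds.2 fun a ha => ?_⟩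
    obtain ⟨U, hU, hinj⟩ := hB.eventually_injOn (hd a)
      (deriv_ne_zero_of_mem_regularValues (hd a) (hreg a))
    have h1 := hΓ.continuousAt.eventually_mem hU
    have h2 := hΓ'.continuousAt.eventually_mem (show U ∈ 𝓝 (Γ' a) by rwa [← show Γ a = Γ' a from ha])
    filter_upwards [h1, h2] with b hb hb' using hinj hb hb' (heq b)
  have := hcl.eq_univ ⟨a₀, h₀⟩
  ext a
  exact (this ▸ mem_univ a : a ∈ {a | Γ a = Γ' a})

/-- `γ` lifts through `B` to a path from `x` to `y` in the disk. -/
def LiftsTo (B : ℂ → ℂ) {a b : ℂ} (γ : Path a b) (x y : ℂ) : Prop :=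
  ∃ Γ : Path x y, ∀ t, Γ t ∈ disk ∧ B (Γ t) = γ t

section LiftsTo
variable {a b c x y z : ℂ} {γ : Path a b} {γ' : Path b c}

theorem LiftsTo.target (h : LiftsTo B γ x y) : y ∈ disk ∧ B y = b := by
  obtain ⟨Γ, h⟩ := h
  simpa using h 1

theorem LiftsTo.symm (h : LiftsTo B γ x y) : LiftsTo B γ.symm y x := by
  obtain ⟨Γ, h⟩ := h
  exact ⟨Γ.symm, fun t => h _⟩

theorem LiftsTo.trans (h : LiftsTo B γ x y) (h' : LiftsTo B γ' y z) :
    LiftsTo B (γ.trans γ') x z := by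
  obtain ⟨Γ, h⟩ := h
  obtain ⟨Γ', h'⟩ := h'
  refine ⟨Γ.trans Γ', fun t => ?_⟩
  simp only [Path.trans_apply]
  split_ifs
  · exact h _
  · exact h' _

theorem LiftsTo.refl (hx : x ∈ disk) : LiftsTo B (Path.refl (B x)) x x :=
  ⟨Path.refl x, fun _ => ⟨hx, rfl⟩⟩

theorem IsBlaschke.liftsTo_unique (hB : IsBlaschke n B) (hγ : ∀ t, γ t ∈ regularValues B)
    (h : LiftsTo B γ x y) (h' : LiftsTo B γ x z) : y = z := by
  obtain ⟨Γ, h⟩ := h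
  obtain ⟨Γ', h'⟩ := h'
  have := hB.lift_unique Γ.continuous Γ'.continuous (fun t => (h t).1)
    (fun t => (h t).2.trans (h' t).2.symm) (fun t => (h t).2 ▸ hγ t) (a₀ := 0) (by simp)
  simpa using congrFun this 1

theorem IsBlaschke.exists_liftsTo (hB : IsBlaschke n B) (hγ : ∀ t, γ t ∈ regularValues B)
    (hx : x ∈ disk) (hxa : B x = a) : ∃ y, LiftsTo B γ x y := by
  -- The path is extended to the real line by constants, lifted there, and the lift restricted to
  -- the interval.
  obtain ⟨Γ, hΓ, h, h0⟩ := hB.exists_lift (A := ℝ) γ.continuous_extend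
    (fun _ => hγ _) (a₀ := 0) hx (by simpa using hxa)
  refine ⟨Γ 1, ⟨⟨fun t => Γ t, by fun_prop⟩, by simpa using h0, by simp⟩, fun t => ?_⟩
  have := h t
  rwa [Path.extend_apply] at this

theorem symm_mem_regularValues (hγ : ∀ t, γ t ∈ regularValues B) (t : unitInterval) :
    γ.symm t ∈ regularValues B := hγ _

theorem trans_mem_regularValues (hγ : ∀ t, γ t ∈ regularValues B)
    (hγ' : ∀ t, γ' t ∈ regularValues B) (t : unitInterval) :
    γ.trans γ' t ∈ regularValues B := by
  simp only [Path.trans_apply]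
  split_ifs
  · exact hγ _
  · exact hγ' _

theorem IsBlaschke.liftsTo_unique_left (hB : IsBlaschke n B) (hγ : ∀ t, γ t ∈ regularValues B)
    (h : LiftsTo B γ x z) (h' : LiftsTo B γ y z) : x = y :=
  hB.liftsTo_unique (symm_mem_regularValues hγ) h.symm h'.symm

end LiftsTo

theorem IsBlaschke.isOpen_regularValues (hB : IsBlaschke n B) : IsOpen (regularValues B) :=
  isOpen_disk.sdiff hB.finite_criticalValues.isClosed

theorem IsBlaschke.isPathConnected_regularValues (hB : IsBlaschke n B) :
    IsPathConnected (regularValues B) := by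
  -- The disk is homeomorphic to the plane, where the complement of a countable set is path
  -- connected.
  set e : ℂ → ℂ := fun z => (Homeomorph.unitBall (E := ℂ) z : ℂ) with he
  have hinj : Function.Injective e := Subtype.val_injective.comp Homeomorph.unitBall.injective
  have hcont : Continuous e := continuous_subtype_val.comp Homeomorph.unitBall.continuous
  have h1 : IsPathConnected (e ⁻¹' criticalValues B)ᶜ :=
    (hB.finite_criticalValues.preimage hinj.injOn).countable.isPathConnected_compl_of_one_lt_rank
      (by rw [Complex.rank_real_complex]; exact Cardinal.one_lt_two)
  convert h1.image hcont using 1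
  ext w
  constructor
  · rintro ⟨hw, hw'⟩
    refine ⟨Homeomorph.unitBall.symm ⟨w, hw⟩, ?_, by simp [he]⟩
    simpa [he] using hw'
  · rintro ⟨z, hz, rfl⟩
    exact ⟨(Homeomorph.unitBall z).2, hz⟩

theorem IsBlaschke.exists_path (hB : IsBlaschke n B) {v w : ℂ} (hv : v ∈ regularValues B)
    (hw : w ∈ regularValues B) : ∃ γ : Path v w, ∀ t, γ t ∈ regularValues B := by
  obtain ⟨γ, hγ⟩ := hB.isPathConnected_regularValues.joinedIn v hv w hw
  exact ⟨γ, hγ⟩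

end

/-! ### Branches and monodromy -/

section
variable {n : ℕ} {I : ℂ → ℂ}

/-- The value of a branch at `0`. -/
noncomputable def Branch.ev (g : Branch I) : ℂ := g.1.value

theorem Branch.exists_rep (g : Branch I) : ∃ f : ℂ → ℂ, AnalyticAt ℂ f 0 ∧
    (∀ᶠ w in 𝓝 (0 : ℂ), f w ∈ disk ∧ I (f w) = w) ∧ (f : Germ (𝓝 (0 : ℂ)) ℂ) = g.1 ∧
    f 0 = g.ev := by
  obtain ⟨f, h1, h2, h3⟩ := g.2
  refine ⟨f, h1, h2, h3, ?_⟩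
  rw [Branch.ev, ← h3]
  rfl

theorem Branch.ev_mem (g : Branch I) : g.ev ∈ disk ∧ I g.ev = 0 := by
  obtain ⟨f, -, h, -, h'⟩ := g.exists_rep
  rw [← h']
  exact h.self_of_nhds

/-- Over a regular value, a local right inverse is determined by its value at one point. This
identifies branches with points of the fiber over `0`. -/
theorem IsBlaschke.eventuallyEq_of_rightInverse (hI : IsBlaschke n I) {u v : ℂ → ℂ} {w : ℂ}
    (hw : w ∈ regularValues I) (hu : ContinuousAt u w) (hv : ContinuousAt v w)
    (hd : u w ∈ disk) (huv : u w = v w) (hu' : ∀ᶠ x in 𝓝 w, I (u x) = x)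
    (hv' : ∀ᶠ x in 𝓝 w, I (v x) = x) : u =ᶠ[𝓝 w] v := by
  obtain ⟨U, hU, hinj⟩ := hI.eventually_injOn hd
    (deriv_ne_zero_of_mem_regularValues hd (hu'.self_of_nhds.symm ▸ hw))
  filter_upwards [hu'.and hv', hu.eventually_mem hU, hv.eventually_mem (huv ▸ hU)]
    with x hx h1 h2 using hinj h1 h2 (hx.1.trans hx.2.symm)

variable (h0 : (0 : ℂ) ∉ criticalValues I)
include h0

theorem IsBlaschke.ev_injective (hI : IsBlaschke n I) :
    Function.Injective (Branch.ev (I := I)) := by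
  intro g h hgh
  obtain ⟨f, hf1, hf2, hf3, hf4⟩ := g.exists_rep
  obtain ⟨k, hk1, hk2, hk3, hk4⟩ := h.exists_rep
  refine Subtype.ext ?_
  rw [← hf3, ← hk3]
  exact Germ.coe_eq.2 (hI.eventuallyEq_of_rightInverse ⟨zero_mem_disk, h0⟩ hf1.continuousAt
    hk1.continuousAt hf2.self_of_nhds.1 (by rw [hf4, hk4, hgh]) (hf2.mono fun _ h => h.2)
    (hk2.mono fun _ h => h.2))

theorem IsBlaschke.exists_branch (hI : IsBlaschke n I) {z : ℂ} (hz : z ∈ disk) (hIz : I z = 0) :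
    ∃ g : Branch I, g.ev = z := by
  obtain ⟨s, hs1, hs2, hs3, -⟩ := exists_localInverse (hI.analyticOnNhd z hz)
    (fun h => h0 ⟨z, hz, h, hIz⟩)
  rw [hIz] at hs1 hs2 hs3
  refine ⟨⟨_, s, hs1, (hs1.continuousAt.eventually_mem (by
    rw [hs2]; exact isOpen_disk.mem_nhds hz)).and hs3, rfl⟩, hs2⟩

theorem IsBlaschke.finite_branch (hI : IsBlaschke n I) : Finite (Branch I) := by
  have := (hI.finite_fiber zero_mem_disk).to_subtype
  exact Finite.of_injective (fun g : Branch I => (⟨g.ev, g.ev_mem⟩ : {z | z ∈ disk ∧ I z = 0}))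
    fun g h hgh => hI.ev_injective h0 (congrArg Subtype.val hgh)

theorem IsBlaschke.zero_mem_regularValues (_hI : IsBlaschke n I) : (0 : ℂ) ∈ regularValues I :=
  ⟨zero_mem_disk, h0⟩

omit h0 in
theorem ContinuesTo.unique {γ : Path (0 : ℂ) 0} {g h h' : Germ (𝓝 (0 : ℂ)) ℂ}
    (H : ContinuesTo γ g h) (H' : ContinuesTo γ g h') : h = h' := by
  obtain ⟨f, hf1, hf2, hf3, hf4⟩ := H
  obtain ⟨k, hk1, hk2, hk3, hk4⟩ := H'
  -- By the identity theorem on a common ball of analyticity, agreement of the two continuations is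
  -- locally constant in the parameter, hence constant.
  have hloc : ∀ t, ∀ᶠ s in 𝓝 t, (f s =ᶠ[𝓝 (γ s)] k s ↔ f t =ᶠ[𝓝 (γ t)] k t) := by
    intro t
    obtain ⟨r, hr, han⟩ := Metric.eventually_nhds_iff_ball.1
      ((hf1 t).eventually_analyticAt.and (hk1 t).eventually_analyticAt)
    filter_upwards [hf2 t, hk2 t,
      γ.continuous.continuousAt.eventually_mem (Metric.ball_mem_nhds (γ t) hr)] with s h1 h2 h3
    have key : ∀ x ∈ Metric.ball (γ t) r, f t =ᶠ[𝓝 x] k t →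
        EqOn (f t) (k t) (Metric.ball (γ t) r) := fun x hx hx' =>
      AnalyticOnNhd.eqOn_of_preconnected_of_eventuallyEq (fun y hy => (han y hy).1)
        (fun y hy => (han y hy).2) (convex_ball _ _).isPreconnected hx hx'
    constructor
    · intro h
      have := key _ h3 (h1.symm.trans (h.trans h2))
      exact this.eventuallyEq_of_mem (Metric.ball_mem_nhds _ hr)
    · intro h
      have := key _ (Metric.mem_ball_self hr) h
      exact h1.trans ((this.eventuallyEq_of_mem (Metric.isOpen_ball.mem_nhds h3)).trans h2.symm)
  have hcl : IsClopen {t | f t =ᶠ[𝓝 (γ t)] k t} := by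
    constructor
    · rw [← isOpen_compl_iff, isOpen_iff_mem_nhds]
      intro t ht
      filter_upwards [hloc t] with s hs using fun h => ht (hs.1 h)
    · rw [isOpen_iff_mem_nhds]
      intro t ht
      filter_upwards [hloc t] with s hs using hs.2 ht
  have h00 : f 0 =ᶠ[𝓝 (γ 0)] k 0 := by
    rw [γ.source]
    exact Germ.coe_eq.1 (hf3.trans hk3.symm)
  have h1 : (1 : unitInterval) ∈ {t | f t =ᶠ[𝓝 (γ t)] k t} := by
    rw [hcl.eq_univ ⟨0, h00⟩]
    trivial
  have h1' : f 1 =ᶠ[𝓝 (γ 1)] k 1 := h1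
  rw [γ.target] at h1'
  rw [← hf4, ← hk4]
  exact Germ.coe_eq.2 h1'

/-- The local inverses of `I` at the points of the lifted path form the continuation. With
uniqueness of continuation, this turns monodromy into path lifting. -/
theorem IsBlaschke.continuesTo_of_liftsTo (hI : IsBlaschke n I) {γ : Path (0 : ℂ) 0}
    (hγ : ∀ t, γ t ∈ regularValues I) {g h : Branch I} (H : LiftsTo I γ g.ev h.ev) :
    ContinuesTo γ g.1 h.1 := by
  obtain ⟨Γ, hΓ⟩ := H
  choose s hs1 hs2 hs3 hs4 using fun t => exists_localInverse (hI.analyticOnNhd _ (hΓ t).1)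
    (deriv_ne_zero_of_mem_regularValues (hΓ t).1 ((hΓ t).2 ▸ hγ t))
  simp only [fun t => (hΓ t).2] at hs1 hs2 hs3 hs4
  have hgerm : ∀ t (k : Branch I), γ t = 0 → Γ t = k.ev →
      (s t : Germ (𝓝 (0 : ℂ)) ℂ) = k.1 := by
    intro t k ht hk
    obtain ⟨f, hf1, hf2, hf3, hf4⟩ := k.exists_rep
    rw [← hf3]
    have h1 := hs1 t
    have h2 := hs2 t
    have h3 := hs3 t
    rw [ht] at h1 h2 h3
    exact Germ.coe_eq.2 (hI.eventuallyEq_of_rightInverse ⟨zero_mem_disk, h0⟩ h1.continuousAt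
      hf1.continuousAt (by rw [h2]; exact (hΓ t).1) (by rw [h2, hf4, hk]) h3
      (hf2.mono fun _ h => h.2))
  refine ⟨s, hs1, fun t => ?_, hgerm 0 g (by simp) (by simp), hgerm 1 h (by simp) (by simp)⟩
  have h1 := (eventually_eventually_nhds.2 (hs4 t))
  filter_upwards [Γ.continuous.continuousAt.eventually h1] with u hu
  have h2 : Tendsto (s u) (𝓝 (γ u)) (𝓝 (Γ u)) := by
    have := (hs1 u).continuousAt.tendsto
    rwa [hs2] at this
  filter_upwards [h2.eventually hu, hs3 u] with w hw hw'
  rw [hw'] at hw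
  exact hw.symm

theorem IsBlaschke.liftsTo_of_continuesTo (hI : IsBlaschke n I) {γ : Path (0 : ℂ) 0}
    (hγ : ∀ t, γ t ∈ regularValues I) {g h : Branch I} (H : ContinuesTo γ g.1 h.1) :
    LiftsTo I γ g.ev h.ev := by
  obtain ⟨y, hy⟩ := hI.exists_liftsTo hγ g.ev_mem.1 g.ev_mem.2
  obtain ⟨k, rfl⟩ := hI.exists_branch h0 hy.target.1 hy.target.2
  have := (hI.continuesTo_of_liftsTo h0 hγ hy).unique H
  rwa [← show k = h from Subtype.ext this]

/-- The generators already form a group: loops can be concatenated and reversed. -/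
theorem IsBlaschke.mem_monodromyGroup_iff (hI : IsBlaschke n I) {σ : Equiv.Perm (Branch I)} :
    σ ∈ monodromyGroup I ↔ ∃ γ : Path (0 : ℂ) 0, (∀ t, γ t ∈ regularValues I) ∧
      ∀ g : Branch I, LiftsTo I γ g.ev (σ g).ev := by
  constructor
  · intro h
    induction h using Subgroup.closure_induction with
    | mem σ hσ =>
      obtain ⟨γ, hγ, h⟩ := hσ
      exact ⟨γ, hγ, fun g => hI.liftsTo_of_continuesTo h0 hγ (h g)⟩
    | one =>
      refine ⟨Path.refl 0, fun t => ⟨zero_mem_disk, h0⟩, fun g => ?_⟩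
      have := LiftsTo.refl (B := I) g.ev_mem.1
      rw [g.ev_mem.2] at this
      exact this
    | mul σ τ _ _ hσ hτ =>
      obtain ⟨γ, hγ, h⟩ := hσ
      obtain ⟨γ', hγ', h'⟩ := hτ
      -- The product `σ * τ` applies `τ` first, so the loop of `τ` is run through first.
      exact ⟨γ'.trans γ, trans_mem_regularValues hγ' hγ, fun g => (h' g).trans (h _)⟩
    | inv σ _ hσ =>
      obtain ⟨γ, hγ, h⟩ := hσ
      refine ⟨γ.symm, symm_mem_regularValues hγ, fun g => ?_⟩
      have := (h (σ⁻¹ g)).symm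
      rwa [← Equiv.Perm.mul_apply, mul_inv_cancel, Equiv.Perm.one_apply] at this
  · rintro ⟨γ, hγ, h⟩
    exact Subgroup.subset_closure ⟨γ, hγ, fun g => hI.continuesTo_of_liftsTo h0 hγ (h g)⟩

theorem IsBlaschke.exists_mem_monodromyGroup (hI : IsBlaschke n I) {γ : Path (0 : ℂ) 0}
    (hγ : ∀ t, γ t ∈ regularValues I) : ∃ σ ∈ monodromyGroup I,
      ∀ g : Branch I, LiftsTo I γ g.ev (σ g).ev := by
  have hex : ∀ g : Branch I, ∃ h : Branch I, LiftsTo I γ g.ev h.ev := by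
    intro g
    obtain ⟨y, hy⟩ := hI.exists_liftsTo hγ g.ev_mem.1 g.ev_mem.2
    obtain ⟨k, rfl⟩ := hI.exists_branch h0 hy.target.1 hy.target.2
    exact ⟨k, hy⟩
  choose f hf using hex
  have hinj : Function.Injective f := by
    intro g h hgh
    have h1 := hf g
    rw [hgh] at h1
    exact hI.ev_injective h0 (hI.liftsTo_unique_left hγ h1 (hf h))
  have := hI.finite_branch h0
  refine ⟨Equiv.ofBijective f (Finite.injective_iff_bijective.1 hinj), ?_, hf⟩
  exact (hI.mem_monodromyGroup_iff h0).2 ⟨γ, hγ, hf⟩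

end

/-! ### Markings: continuing all branches along one path -/

section
variable {n : ℕ} {I : ℂ → ℂ}

/-- `L` gives the end points of the lifts, starting at the values of the branches, of one path
from `0` to `w`. -/
def IsMarking (I : ℂ → ℂ) (w : ℂ) (L : Branch I → ℂ) : Prop :=
  ∃ γ : Path (0 : ℂ) w, (∀ t, γ t ∈ regularValues I) ∧ ∀ g, LiftsTo I γ g.ev (L g)

theorem IsMarking.mem {w : ℂ} {L : Branch I → ℂ} (hL : IsMarking I w L) (g : Branch I) :
    L g ∈ disk ∧ I (L g) = w := by
  obtain ⟨γ, hγ, h⟩ := hL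
  exact (h g).target

theorem IsMarking.mem_regularValues {w : ℂ} {L : Branch I → ℂ} (hL : IsMarking I w L) :
    w ∈ regularValues I := by
  obtain ⟨γ, hγ, h⟩ := hL
  simpa using hγ 1

theorem IsBlaschke.marking_injective (hI : IsBlaschke n I) (h0 : (0 : ℂ) ∉ criticalValues I)
    {w : ℂ} {L : Branch I → ℂ} (hL : IsMarking I w L) : Function.Injective L := by
  obtain ⟨γ, hγ, h⟩ := hL
  intro g k hgk
  have h1 := h g
  rw [hgk] at h1
  exact hI.ev_injective h0 (hI.liftsTo_unique_left hγ h1 (h k))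

theorem IsBlaschke.marking_surjective (hI : IsBlaschke n I) (h0 : (0 : ℂ) ∉ criticalValues I)
    {w z : ℂ} {L : Branch I → ℂ} (hL : IsMarking I w L) (hz : z ∈ disk) (hw : I z = w) :
    ∃ g, L g = z := by
  obtain ⟨γ, hγ, h⟩ := hL
  obtain ⟨y, hy⟩ := hI.exists_liftsTo (symm_mem_regularValues hγ) hz hw
  obtain ⟨g, rfl⟩ := hI.exists_branch h0 hy.target.1 hy.target.2
  refine ⟨g, hI.liftsTo_unique hγ (h g) ?_⟩
  simpa using hy.symm

theorem IsBlaschke.exists_marking (hI : IsBlaschke n I) (h0 : (0 : ℂ) ∉ criticalValues I)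
    {w : ℂ} (hw : w ∈ regularValues I) : ∃ L, IsMarking I w L := by
  obtain ⟨γ, hγ⟩ := hI.exists_path (hI.zero_mem_regularValues h0) hw
  choose L hL using fun g : Branch I => hI.exists_liftsTo hγ g.ev_mem.1 g.ev_mem.2
  exact ⟨L, γ, hγ, hL⟩

theorem IsBlaschke.isMarking_ev (_hI : IsBlaschke n I) (h0 : (0 : ℂ) ∉ criticalValues I) :
    IsMarking I 0 Branch.ev := by
  refine ⟨Path.refl 0, fun t => ⟨zero_mem_disk, h0⟩, fun g => ?_⟩
  have := LiftsTo.refl (B := I) g.ev_mem.1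
  rw [g.ev_mem.2] at this
  exact this

/-- Going out along one path and back along the other is a loop at `0`; its monodromy is the
ambiguity of a marking. -/
theorem IsBlaschke.exists_marking_eq_comp (hI : IsBlaschke n I)
    (h0 : (0 : ℂ) ∉ criticalValues I) {w : ℂ} {L L' : Branch I → ℂ} (hL : IsMarking I w L)
    (hL' : IsMarking I w L') : ∃ σ ∈ monodromyGroup I, ∀ g, L' g = L (σ g) := by
  obtain ⟨γ, hγ, h⟩ := hL
  obtain ⟨γ', hγ', h'⟩ := hL'
  have hγγ := trans_mem_regularValues hγ' (symm_mem_regularValues hγ)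
  obtain ⟨σ, hσ, hσ'⟩ := hI.exists_mem_monodromyGroup h0 hγγ
  refine ⟨σ, hσ, fun g => ?_⟩
  obtain ⟨k, hk⟩ := hI.marking_surjective h0 ⟨γ, hγ, h⟩ (h' g).target.1 (h' g).target.2
  have h1 : LiftsTo I (γ'.trans γ.symm) g.ev k.ev := (h' g).trans (hk ▸ (h k).symm)
  rw [← hk, hI.ev_injective h0 (hI.liftsTo_unique hγγ h1 (hσ' g))]

/-- Local inverses of `I` carry a marking analytically to nearby points: append a short path inside
the ball. -/
theorem IsBlaschke.exists_marking_nhds (hI : IsBlaschke n I) (h0 : (0 : ℂ) ∉ criticalValues I)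
    {w₀ : ℂ} {L : Branch I → ℂ} (hL : IsMarking I w₀ L) :
    ∃ r > 0, Metric.ball w₀ r ⊆ regularValues I ∧ ∃ Λ : ℂ → Branch I → ℂ, Λ w₀ = L ∧
      (∀ w ∈ Metric.ball w₀ r, IsMarking I w (Λ w)) ∧
      ∀ g, AnalyticOnNhd ℂ (fun w => Λ w g) (Metric.ball w₀ r) := by
  have := hI.finite_branch h0
  have hw₀ := hL.mem_regularValues
  choose s hs1 hs2 hs3 hs4 using fun g => exists_localInverse (hI.analyticOnNhd _ (hL.mem g).1)
    (deriv_ne_zero_of_mem_regularValues (hL.mem g).1 ((hL.mem g).2 ▸ hw₀))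
  simp only [fun g => (hL.mem g).2] at hs1 hs2 hs3 hs4
  have hev : ∀ᶠ w in 𝓝 w₀, w ∈ regularValues I ∧
      ∀ g, s g w ∈ disk ∧ I (s g w) = w ∧ AnalyticAt ℂ (s g) w := by
    refine (hI.isOpen_regularValues.mem_nhds hw₀ |> Filter.eventually_mem_set.2).and
      (eventually_all.2 fun g => ?_)
    refine ((hs1 g).continuousAt.eventually_mem ?_).and
      ((hs3 g).and (hs1 g).eventually_analyticAt)
    rw [hs2]
    exact isOpen_disk.mem_nhds (hL.mem g).1
  obtain ⟨r, hr, h⟩ := Metric.eventually_nhds_iff_ball.1 hev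
  refine ⟨r, hr, fun w hw => (h w hw).1, fun w g => s g w, funext hs2, fun w hw => ?_,
    fun g w hw => ((h w hw).2 g).2.2⟩
  obtain ⟨γ, hγ, hγL⟩ := hL
  obtain ⟨δ, hδ⟩ := ((convex_ball w₀ r).isPathConnected ⟨w₀, Metric.mem_ball_self hr⟩).joinedIn
    w₀ (Metric.mem_ball_self hr) w hw
  refine ⟨γ.trans δ, trans_mem_regularValues hγ fun t => (h _ (hδ t)).1, fun g => ?_⟩
  refine (hγL g).trans ?_
  have hcont : ContinuousOn (s g) (range δ) := by
    rintro _ ⟨t, rfl⟩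
    exact ((h _ (hδ t)).2 g).2.2.continuousAt.continuousWithinAt
  refine ⟨(δ.map' hcont).cast (hs2 g).symm rfl, fun t => ?_⟩
  exact ⟨((h _ (hδ t)).2 g).1, ((h _ (hδ t)).2 g).2.1⟩

end

/-! ### Transitivity of a cyclic subgroup of the monodromy group -/

/-- A vertical strip, mapped by the exponential function onto the annulus `ρ < ‖w‖ < 1`. -/
def strip (ρ : ℝ) : Set ℂ := {ζ | Real.log ρ < ζ.re ∧ ζ.re < 0}

theorem convex_strip (ρ : ℝ) : Convex ℝ (strip ρ) :=
  (convex_Ioo (Real.log ρ) 0).linear_preimage Complex.reLm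

theorem isOpen_strip (ρ : ℝ) : IsOpen (strip ρ) :=
  isOpen_Ioo.preimage Complex.continuous_re

theorem log_mem_strip {ρ t : ℝ} (h0 : 0 < ρ) (h1 : ρ < t) (h2 : t < 1) :
    ((Real.log t : ℝ) : ℂ) ∈ strip ρ :=
  ⟨by simpa using Real.log_lt_log h0 h1, by simpa using Real.log_neg (h0.trans h1) h2⟩

theorem norm_exp_mem_of_mem_strip {ρ : ℝ} (h0 : 0 < ρ) {ζ : ℂ} (h : ζ ∈ strip ρ) :
    ρ < ‖Complex.exp ζ‖ ∧ ‖Complex.exp ζ‖ < 1 := by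
  rw [Complex.norm_exp]
  exact ⟨(Real.log_lt_iff_lt_exp h0).1 h.1, by simpa using h.2⟩

theorem exists_mem_strip_exp_eq {ρ : ℝ} (h0 : 0 < ρ) {w : ℂ} (h1 : ρ < ‖w‖) (h2 : ‖w‖ < 1) :
    ∃ ζ ∈ strip ρ, Complex.exp ζ = w := by
  have hw : w ≠ 0 := norm_pos_iff.1 (h0.trans h1)
  refine ⟨Complex.log w, ?_, Complex.exp_log hw⟩
  simp only [strip, mem_ofPred_eq, Complex.log_re]
  exact ⟨Real.log_lt_log h0 h1, Real.log_neg (h0.trans h1) h2⟩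

theorem isPreconnected_annulus {r : ℝ} (h0 : 0 < r) :
    IsPreconnected {z : ℂ | z ∈ disk ∧ r < ‖z‖} := by
  convert (convex_strip r).isPreconnected.image Complex.exp Complex.continuous_exp.continuousOn
    using 1
  ext z
  constructor
  · rintro ⟨h1, h2⟩
    exact exists_mem_strip_exp_eq h0 h2 (mem_disk.1 h1)
  · rintro ⟨ζ, hζ, rfl⟩
    exact ⟨mem_disk.2 (norm_exp_mem_of_mem_strip h0 hζ).2, (norm_exp_mem_of_mem_strip h0 hζ).1⟩

theorem add_mem_strip {ρ : ℝ} {ζ : ℂ} (h : ζ ∈ strip ρ) (t : ℝ) :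
    ζ + t * (2 * Real.pi * Complex.I) ∈ strip ρ := by
  simpa [strip] using h

/-- `E` lifts the exponential function through `I` on a strip. -/
def IsExpLift (I : ℂ → ℂ) (ρ : ℝ) (E : ℂ → ℂ) : Prop :=
  ContinuousOn E (strip ρ) ∧ ∀ ζ ∈ strip ρ, E ζ ∈ disk ∧ I (E ζ) = Complex.exp ζ

section
variable {n : ℕ} {I : ℂ → ℂ} {ρ : ℝ}

theorem IsExpLift.translate {E : ℂ → ℂ} (hE : IsExpLift I ρ E) (j : ℤ) :
    IsExpLift I ρ (fun ζ => E (ζ + j * (2 * Real.pi * Complex.I))) := by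
  have hmem : ∀ ζ ∈ strip ρ, ζ + j * (2 * Real.pi * Complex.I) ∈ strip ρ := fun ζ hζ => by
    simpa using add_mem_strip hζ j
  refine ⟨hE.1.comp (by fun_prop) hmem, fun ζ hζ => ⟨(hE.2 _ (hmem ζ hζ)).1, ?_⟩⟩
  rw [(hE.2 _ (hmem ζ hζ)).2]
  exact Complex.exp_eq_exp_iff_exists_int.2 ⟨j, rfl⟩

variable (hI : IsBlaschke n I) (h0 : 0 < ρ) (hρ : ∀ w ∈ disk, ρ < ‖w‖ → w ∉ criticalValues I)
include hI h0 hρ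

omit hI in
theorem exp_mem_regularValues {ζ : ℂ} (hζ : ζ ∈ strip ρ) :
    Complex.exp ζ ∈ regularValues I := by
  have h := norm_exp_mem_of_mem_strip h0 hζ
  have h1 := mem_disk.2 h.2
  exact ⟨h1, hρ _ h1 h.1⟩

theorem exists_isExpLift {ζ z : ℂ} (hζ : ζ ∈ strip ρ) (hz : z ∈ disk)
    (h : I z = Complex.exp ζ) : ∃ E, IsExpLift I ρ E ∧ E ζ = z := by
  have : ContractibleSpace (strip ρ) := (convex_strip ρ).contractibleSpace ⟨ζ, hζ⟩
  have : LocallyPathConnectedSpace (strip ρ) := (isOpen_strip ρ).locallyPathConnectedSpace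
  obtain ⟨Γ, hΓ, hΓI, hΓζ⟩ := hI.exists_lift (A := strip ρ) (γ := fun ζ => Complex.exp ζ)
    (by fun_prop) (fun ζ => exp_mem_regularValues h0 hρ ζ.2) (a₀ := ⟨ζ, hζ⟩) hz h
  have hext : ∀ ξ : strip ρ, Function.extend (Subtype.val : strip ρ → ℂ) Γ 0 ξ = Γ ξ :=
    Subtype.val_injective.extend_apply Γ 0
  refine ⟨Function.extend Subtype.val Γ 0, ⟨?_, fun ξ hξ => ?_⟩, ?_⟩
  · rw [continuousOn_iff_continuous_domRestrict]
    convert hΓ using 1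
    ext ξ
    exact hext ξ
  · rw [hext ⟨ξ, hξ⟩]
    exact hΓI _
  · rw [hext ⟨ζ, hζ⟩, hΓζ]

theorem IsExpLift.eqOn {E E' : ℂ → ℂ} (hE : IsExpLift I ρ E) (hE' : IsExpLift I ρ E') {ζ : ℂ}
    (hζ : ζ ∈ strip ρ) (h : E ζ = E' ζ) : EqOn E E' (strip ρ) := by
  have : PreconnectedSpace (strip ρ) :=
    isPreconnected_iff_preconnectedSpace.1 (convex_strip ρ).isPreconnected
  have := hI.lift_unique (A := strip ρ) (continuousOn_iff_continuous_domRestrict.1 hE.1)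
    (continuousOn_iff_continuous_domRestrict.1 hE'.1) (fun ξ => (hE.2 ξ ξ.2).1)
    (fun ξ => (hE.2 ξ ξ.2).2.trans (hE'.2 ξ ξ.2).2.symm)
    (fun ξ => by
      have := exp_mem_regularValues h0 hρ ξ.2
      rw [← (hE.2 ξ ξ.2).2] at this
      exact this) (a₀ := ⟨ζ, hζ⟩) h
  intro ξ hξ
  exact congrFun this ⟨ξ, hξ⟩

theorem IsExpLift.isOpen_image {E : ℂ → ℂ} (hE : IsExpLift I ρ E) : IsOpen (E '' strip ρ) := by
  rw [isOpen_iff_mem_nhds]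
  rintro _ ⟨ζ, hζ, rfl⟩
  obtain ⟨hd, hIE⟩ := hE.2 ζ hζ
  obtain ⟨U, hU, hinj⟩ := hI.eventually_injOn hd (deriv_ne_zero_of_mem_regularValues hd
    (hIE ▸ exp_mem_regularValues h0 hρ hζ))
  -- The branch of `log ∘ I` that takes the value `ζ` at `E ζ`. Local injectivity of `I` gives `E (l
  -- y) = y`, so nearby points are in the image of `E`.
  set l : ℂ → ℂ := fun y => ζ + Complex.log (I y / Complex.exp ζ) with hl
  have hIc : ContinuousAt I (E ζ) := (hI.analyticOnNhd _ hd).continuousAt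
  have hlc : ContinuousAt l (E ζ) := by
    refine continuousAt_const.add (ContinuousAt.clog (hIc.div_const _) ?_)
    rw [hIE, div_self (Complex.exp_ne_zero _)]
    simp
  have hlz : l (E ζ) = ζ := by simp [hl, hIE]
  have h1 : ∀ᶠ y in 𝓝 (E ζ), l y ∈ strip ρ :=
    hlc.eventually_mem (by rw [hlz]; exact (isOpen_strip ρ).mem_nhds hζ)
  have hEc : ContinuousAt (E ∘ l) (E ζ) := by
    refine ContinuousAt.comp ?_ hlc
    rw [hlz]
    exact hE.1.continuousAt ((isOpen_strip ρ).mem_nhds hζ)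
  have h2 : ∀ᶠ y in 𝓝 (E ζ), E (l y) ∈ U :=
    hEc.eventually_mem (by simpa [hlz] using hU)
  have h3 : ∀ᶠ y in 𝓝 (E ζ), I y ≠ 0 :=
    hIc.eventually_ne (by rw [hIE]; exact Complex.exp_ne_zero _)
  filter_upwards [h1, h2, h3, hU] with y hy1 hy2 hy3 hy4
  refine ⟨l y, hy1, hinj hy2 hy4 ?_⟩
  rw [(hE.2 _ hy1).2, hl]
  simp only
  rw [Complex.exp_add, Complex.exp_log (div_ne_zero hy3 (Complex.exp_ne_zero _)),
    mul_div_cancel₀ _ (Complex.exp_ne_zero _)]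

/-- Two lifts with a common value differ by a translation by a multiple of `2πi`, which preserves
the strip. -/
theorem IsExpLift.image_subset {E E' : ℂ → ℂ} (hE : IsExpLift I ρ E) (hE' : IsExpLift I ρ E')
    (h : (E '' strip ρ ∩ E' '' strip ρ).Nonempty) : E '' strip ρ ⊆ E' '' strip ρ := by
  obtain ⟨_, ⟨ζ, hζ, rfl⟩, ζ', hζ', he⟩ := h
  have h1 : Complex.exp ζ' = Complex.exp ζ := by
    rw [← (hE.2 ζ hζ).2, ← (hE'.2 ζ' hζ').2, he]
  obtain ⟨j, rfl⟩ := Complex.exp_eq_exp_iff_exists_int.1 h1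
  have := IsExpLift.eqOn hI h0 hρ hE (hE'.translate j) hζ he.symm
  rintro _ ⟨ξ, hξ, rfl⟩
  rw [this hξ]
  exact ⟨_, by simpa using add_mem_strip hξ j, rfl⟩

/-- The images of lifts are open, pairwise equal or disjoint, and cover the preimage of the annulus
`ρ < |w| < 1`. That preimage contains a connected annulus at the boundary which every image meets,
so there is only one image. -/
theorem IsExpLift.image_eq {E E' : ℂ → ℂ} (hE : IsExpLift I ρ E) (hE' : IsExpLift I ρ E') :
    E '' strip ρ = E' '' strip ρ := by
  have hρ1 : ρ < 1 → ∃ r < 1, 0 < r ∧ ∀ z ∈ disk, r < ‖z‖ → ρ < ‖I z‖ := fun h =>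
    eventually_boundary_iff.1 (hI.tendsto_norm.eventually (lt_mem_nhds h))
  rcases le_or_gt 1 ρ with h1 | h1
  · have : strip ρ = ∅ := by
      ext ζ
      simp only [strip, mem_ofPred_eq, mem_empty_iff_false, iff_false, not_and, not_lt]
      intro h
      exact (Real.log_nonneg h1).trans h.le
    simp [this]
  obtain ⟨r, hr1, hr0, hr⟩ := hρ1 h1
  obtain ⟨t, ht1, ht0, ht⟩ := hI.exists_lt_norm hr0.le hr1
  set Ann : Set ℂ := {z | z ∈ disk ∧ r < ‖z‖} with hAnn
  have hmeet : ∀ F, IsExpLift I ρ F → (Ann ∩ F '' strip ρ).Nonempty := by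
    intro F hF
    obtain ⟨u, hu, hu1⟩ := exists_between (max_lt h1 ht1)
    have hu0 : 0 < u := h0.trans ((le_max_left _ _).trans_lt hu)
    have hmem := log_mem_strip h0 ((le_max_left _ _).trans_lt hu) hu1
    refine ⟨_, ⟨(hF.2 _ hmem).1, ht _ (hF.2 _ hmem).1 ?_⟩, _, hmem, rfl⟩
    rw [(hF.2 _ hmem).2, ← Complex.ofReal_exp, Real.exp_log hu0, Complex.norm_real,
      Real.norm_of_nonneg hu0.le]
    exact ((le_max_right _ _).trans_lt hu).le
  have hsub : ∀ F, IsExpLift I ρ F → Ann ⊆ F '' strip ρ := by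
    intro F hF
    refine (isPreconnected_annulus hr0).subset_left_of_subset_union
      (v := ⋃ G ∈ {G | IsExpLift I ρ G ∧ Disjoint (F '' strip ρ) (G '' strip ρ)}, G '' strip ρ)
      (IsExpLift.isOpen_image hI h0 hρ hF)
      (isOpen_biUnion fun G hG => IsExpLift.isOpen_image hI h0 hρ hG.1)
      (disjoint_iUnion₂_right.2 fun G hG => hG.2) ?_ (hmeet F hF)
    intro z hz
    obtain ⟨ζ, hζ, hζz⟩ := exists_mem_strip_exp_eq h0 (hr z hz.1 hz.2)
      (mem_disk.1 (hI.mapsTo hz.1))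
    obtain ⟨G, hG, rfl⟩ := exists_isExpLift hI h0 hρ hζ hz.1 hζz.symm
    by_cases hd : Disjoint (F '' strip ρ) (G '' strip ρ)
    · exact Or.inr (mem_biUnion (show G ∈ {G | _} from ⟨hG, hd⟩) ⟨ζ, hζ, rfl⟩)
    · refine Or.inl (IsExpLift.image_subset hI h0 hρ hG hF ?_ ⟨ζ, hζ, rfl⟩)
      rw [inter_comm]
      exact not_disjoint_iff_nonempty_inter.1 hd
  obtain ⟨z, hz, hzE⟩ := hmeet E hE
  have hne : (E '' strip ρ ∩ E' '' strip ρ).Nonempty := ⟨z, hzE, hsub E' hE' hz⟩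
  refine Subset.antisymm (IsExpLift.image_subset hI h0 hρ hE hE' hne)
    (IsExpLift.image_subset hI h0 hρ hE' hE ?_)
  rwa [inter_comm]

end

/-- Some element of the monodromy group generates a transitive subgroup. -/
theorem IsBlaschke.exists_transitive_cyclic {n : ℕ} {I : ℂ → ℂ} (hI : IsBlaschke n I)
    (h0 : (0 : ℂ) ∉ criticalValues I) :
    ∃ τ ∈ monodromyGroup I, ∀ g h : Branch I, ∃ j : ℤ, (τ ^ j) g = h := by
  obtain ⟨ρ, hρ0, hρ1, hρ⟩ : ∃ ρ : ℝ, 0 < ρ ∧ ρ < 1 ∧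
      ∀ w ∈ disk, ρ < ‖w‖ → w ∉ criticalValues I := by
    have h1 : ∀ w ∈ criticalValues I, ‖w‖ < 1 := by
      rintro _ ⟨z, hz, -, rfl⟩
      exact mem_disk.1 (hI.mapsTo hz)
    have hev : ∀ᶠ r in 𝓝[<] (1 : ℝ), ∀ w ∈ criticalValues I, ‖w‖ < r :=
      (hI.finite_criticalValues.eventually_all).2 fun w hw =>
        mem_nhdsWithin_of_mem_nhds (lt_mem_nhds (h1 w hw))
    have hpos : ∀ᶠ r in 𝓝[<] (1 : ℝ), 0 < r := mem_nhdsWithin_of_mem_nhds (lt_mem_nhds one_pos)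
    have hlt : ∀ᶠ r in 𝓝[<] (1 : ℝ), r < 1 := eventually_mem_nhdsWithin
    obtain ⟨ρ, h2, h3, h4⟩ := (hev.and (hpos.and hlt)).exists
    exact ⟨ρ, h3, h4, fun w _ hw hc => lt_asymm hw (h2 w hc)⟩
  obtain ⟨t, ht, ht1⟩ := exists_between hρ1
  set ζ₀ : ℂ := ((Real.log t : ℝ) : ℂ) with hζ₀
  have hζ₀S : ζ₀ ∈ strip ρ := log_mem_strip hρ0 ht ht1
  obtain ⟨L, hL⟩ := hI.exists_marking h0 (exp_mem_regularValues hρ0 hρ hζ₀S)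
  choose E hE hE0 using fun g => exists_isExpLift hI hρ0 hρ hζ₀S (hL.mem g).1 (hL.mem g).2
  set T : ℂ := 2 * Real.pi * Complex.I with hT
  have hcirc : ∀ s : unitInterval, ζ₀ + ((s : ℝ) : ℂ) * T ∈ strip ρ :=
    fun s => add_mem_strip hζ₀S s
  -- Appending one turn around the circle `|w| = t` replaces `L g` by the value of `E g` one period
  -- later; the resulting permutation is `τ`.
  have hL' : IsMarking I (Complex.exp ζ₀) fun g => E g (ζ₀ + T) := by
    obtain ⟨γ, hγ, hγL⟩ := hL
    let δ : Path (Complex.exp ζ₀) (Complex.exp ζ₀) :=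
      { toFun := fun s => Complex.exp (ζ₀ + ((s : ℝ) : ℂ) * T)
        continuous_toFun := by fun_prop
        source' := by simp
        target' := by simp [Complex.exp_add, hT, Complex.exp_two_pi_mul_I] }
    refine ⟨γ.trans δ, trans_mem_regularValues hγ fun s =>
      exp_mem_regularValues hρ0 hρ (hcirc s), fun g => (hγL g).trans ?_⟩
    refine ⟨{ toFun := fun s => E g (ζ₀ + ((s : ℝ) : ℂ) * T)
              continuous_toFun := (hE g).1.comp_continuous (by fun_prop) hcirc
              source' := by simp [hE0]
              target' := by simp }, fun s => (hE g).2 _ (hcirc s)⟩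
  obtain ⟨τ, hτ, hτL⟩ := hI.exists_marking_eq_comp h0 hL hL'
  have hstep : ∀ g, ∀ ζ ∈ strip ρ, E g (ζ + T) = E (τ g) ζ := by
    intro g
    have h1 := (hE g).translate 1
    simp only [Int.cast_one, one_mul, ← hT] at h1
    refine IsExpLift.eqOn hI hρ0 hρ h1 (hE (τ g)) hζ₀S ?_
    rw [hE0]
    exact hτL g
  have hpow : ∀ (k : ℕ) (g : Branch I), ∀ ζ ∈ strip ρ, E g (ζ + k * T) = E ((τ ^ k) g) ζ := by
    intro k
    induction k with
    | zero => simp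
    | succ k ih =>
      intro g ζ hζ
      have hζ' : ζ + k * T ∈ strip ρ := by simpa using add_mem_strip hζ k
      rw [pow_succ, Equiv.Perm.mul_apply, ← ih _ _ hζ, ← hstep _ _ hζ']
      congr 1
      push_cast
      ring
  have hnat : ∀ (k : ℕ) (g h : Branch I), E g (ζ₀ + k * T) = L h → (τ ^ k) g = h := by
    intro k g h hgh
    rw [hpow k g ζ₀ hζ₀S, hE0] at hgh
    exact hI.marking_injective h0 hL hgh
  refine ⟨τ, hτ, fun g h => ?_⟩
  -- All lifts have the same image, so `L h` is the value of `E g` at a point over the same base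
  -- point, that is, at `ζ₀` plus a whole number of periods.
  have hmem : L h ∈ E g '' strip ρ := by
    rw [IsExpLift.image_eq hI hρ0 hρ (hE g) (hE h), ← hE0 h]
    exact ⟨ζ₀, hζ₀S, rfl⟩
  obtain ⟨ζ, hζ, hζh⟩ := hmem
  have hexp : Complex.exp ζ = Complex.exp ζ₀ := by
    rw [← ((hE g).2 ζ hζ).2, hζh, (hL.mem h).2]
  obtain ⟨j, rfl⟩ := Complex.exp_eq_exp_iff_exists_int.1 hexp
  rcases Int.eq_nat_or_neg j with ⟨k, rfl | rfl⟩
  · refine ⟨k, ?_⟩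
    rw [zpow_natCast]
    refine hnat k g h ?_
    rw [← hζh]
    push_cast
    rfl
  -- For a negative number of periods, exchange `g` and `h`: `k` periods lead from `h` to `g`.
  · refine ⟨-k, ?_⟩
    have h1 : EqOn (E h) (fun ζ => E g (ζ + ((-k : ℤ) : ℂ) * T)) (strip ρ) :=
      IsExpLift.eqOn hI hρ0 hρ (hE h) ((hE g).translate (-k)) hζ₀S (by rw [hE0]; exact hζh.symm)
    have h2 : (τ ^ k) h = g := by
      refine hnat k h g ?_
      have hk : ζ₀ + (k : ℂ) * T ∈ strip ρ := by simpa using add_mem_strip hζ₀S k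
      have hk' : ζ₀ + (k : ℂ) * T + ((-k : ℤ) : ℂ) * T = ζ₀ := by
        push_cast
        ring
      simp only [h1 hk, hk', hE0]
    rw [zpow_neg, zpow_natCast, ← h2, ← Equiv.Perm.mul_apply, inv_mul_cancel, Equiv.Perm.one_apply]

/-! ### Functions on the disk given by products over invariant families of branches -/

/-- Riemann's removable singularity theorem for finitely many singularities. -/
theorem exists_differentiableOn_extension {U F : Set ℂ} (hU : IsOpen U) (hF : F.Finite)
    {f : ℂ → ℂ} (hf : DifferentiableOn ℂ f (U \ F)) {M : ℝ} (hM : ∀ z ∈ U \ F, ‖f z‖ ≤ M) :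
    ∃ g : ℂ → ℂ, DifferentiableOn ℂ g U ∧ EqOn g f (U \ F) := by
  classical
  set g : ℂ → ℂ := fun z => if z ∈ F then limUnder (𝓝[≠] z) f else f z with hg
  have hgf : ∀ z, z ∉ F → g z = f z := fun z hz => if_neg hz
  refine ⟨g, fun z hz => ?_, fun z hz => hgf z hz.2⟩
  have hV : U \ (F \ {z}) ∈ 𝓝 z :=
    (hU.sdiff (hF.subset sdiff_subset).isClosed).mem_nhds ⟨hz, fun h => h.2 rfl⟩
  have hsub : (U \ (F \ {z})) \ {z} ⊆ U \ F := by
    rintro w ⟨⟨h1, h2⟩, h3⟩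
    exact ⟨h1, fun h => h2 ⟨h, h3⟩⟩
  have hnear : ∀ w ∈ U \ (F \ {z}), w ≠ z → g w = f w :=
    fun w hw hwz => hgf w (hsub ⟨hw, hwz⟩).2
  by_cases hzF : z ∈ F
  · have h1 := Complex.differentiableOn_update_limUnder_of_bddAbove hV (hf.mono hsub) (by
      refine ⟨M, ?_⟩
      rintro _ ⟨w, hw, rfl⟩
      exact hM w (hsub hw))
    refine ((h1.differentiableAt hV).congr_of_eventuallyEq ?_).differentiableWithinAt
    filter_upwards [hV] with w hw
    by_cases hwz : w = z
    · subst hwz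
      simp [hg, hzF]
    · rw [Function.update_of_ne hwz, hnear w hw hwz]
  · have h1 : U \ F ∈ 𝓝 z := (hU.sdiff hF.isClosed).mem_nhds ⟨hz, hzF⟩
    refine ((hf.differentiableAt h1).congr_of_eventuallyEq ?_).differentiableWithinAt
    filter_upwards [h1] with w hw using hgf w hw.2

section
variable {n : ℕ} {I : ℂ → ℂ}

theorem IsBlaschke.finite_preimage_criticalValues (hI : IsBlaschke n I) :
    {z | z ∈ disk ∧ I z ∈ criticalValues I}.Finite := by
  have h1 : criticalValues I ⊆ disk := by
    rintro _ ⟨z, hz, -, rfl⟩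
    exact hI.mapsTo hz
  refine (hI.finite_criticalValues.biUnion fun w hw => hI.finite_fiber (h1 hw)).subset ?_
  rintro z ⟨hz, hz'⟩
  exact mem_biUnion hz' ⟨hz, rfl⟩

theorem IsBlaschke.exists_marking_eq (hI : IsBlaschke n I) (h0 : (0 : ℂ) ∉ criticalValues I)
    {z : ℂ} (hz : z ∈ disk) (hIz : I z ∈ regularValues I) :
    ∃ L : Branch I → ℂ, IsMarking I (I z) L ∧ ∃ g, L g = z := by
  obtain ⟨L, hL⟩ := hI.exists_marking h0 hIz
  exact ⟨L, hL, hI.marking_surjective h0 hL hz rfl⟩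

/-- A function given near `0` by the products of the branches in the members of an invariant family
extends to a finite Blaschke product. -/
theorem IsBlaschke.exists_prod_family (hI : IsBlaschke n I) (h0 : (0 : ℂ) ∉ criticalValues I)
    {m : ℕ} {ψ : ℂ → ℂ} (hψ : IsBlaschke m ψ) (S : Branch I → Finset (Branch I))
    (hS : ∀ σ ∈ monodromyGroup I, ∀ g h, h ∈ S g ↔ σ h ∈ S (σ g)) (hne : ∀ g, (S g).Nonempty) :
    ∃ (C : ℂ → ℂ) (k : ℕ), IsBlaschke k C ∧ ∀ w L, IsMarking I w L →
      ∀ g, C (L g) = ∏ h ∈ S g, ψ (L h) := by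
  classical
  set F : Set ℂ := {z | z ∈ disk ∧ I z ∈ criticalValues I} with hF
  have hFfin : F.Finite := hI.finite_preimage_criticalValues
  have hreg : ∀ z ∈ disk \ F, I z ∈ regularValues I := fun z hz =>
    ⟨hI.mapsTo hz.1, fun h => hz.2 ⟨hz.1, h⟩⟩
  -- The value is computed from an arbitrary marking at `I z` and the label of `z` in it.
  -- Equivariance of `S` makes it independent of that choice, which is `hcL`.
  set c : ℂ → ℂ := fun z => if h : ∃ p : (Branch I → ℂ) × Branch I,
    IsMarking I (I z) p.1 ∧ p.1 p.2 = z then ∏ k ∈ S h.choose.2, ψ (h.choose.1 k) else 0 with hc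
  have hcL : ∀ w L, IsMarking I w L → ∀ g, c (L g) = ∏ h ∈ S g, ψ (L h) := by
    intro w L hL g
    have hIL := (hL.mem g).2
    have hex : ∃ p : (Branch I → ℂ) × Branch I, IsMarking I (I (L g)) p.1 ∧ p.1 p.2 = L g :=
      ⟨(L, g), by rwa [hIL], rfl⟩
    simp only [hc, dif_pos hex]
    obtain ⟨h1, h2⟩ := hex.choose_spec
    generalize hex.choose = p at h1 h2
    rw [hIL] at h1
    obtain ⟨σ, hσ, hσL⟩ := hI.exists_marking_eq_comp h0 hL h1
    rw [hσL] at h2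
    have h3 := hI.marking_injective h0 hL h2
    refine Finset.prod_equiv σ (fun k => ?_) (fun k _ => by rw [hσL])
    rw [← h3]
    exact hS σ hσ _ _
  have han : ∀ z ∈ disk \ F, AnalyticAt ℂ c z := by
    intro z hz
    obtain ⟨L, hL, g, rfl⟩ := hI.exists_marking_eq h0 hz.1 (hreg z hz)
    obtain ⟨r, hr, hball, Λ, hΛ0, hΛ, hΛan⟩ := hI.exists_marking_nhds h0 hL
    have hIan := hI.analyticOnNhd _ hz.1
    have hΛan' : ∀ h, AnalyticAt ℂ (fun y => Λ (I y) h) (L g) := fun h =>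
      (hΛan h _ (Metric.mem_ball_self hr)).comp hIan
    obtain ⟨U, hU, hinj⟩ := hI.eventually_injOn hz.1
      (deriv_ne_zero_of_mem_regularValues hz.1 (hreg _ hz))
    have h1 : ∀ᶠ y in 𝓝 (L g), I y ∈ Metric.ball (I (L g)) r :=
      hIan.continuousAt.eventually_mem (Metric.ball_mem_nhds _ hr)
    have h2 : ∀ᶠ y in 𝓝 (L g), Λ (I y) g ∈ U :=
      (hΛan' g).continuousAt.eventually_mem (by rwa [hΛ0])
    have heq : (fun y => ∏ h ∈ S g, ψ (Λ (I y) h)) =ᶠ[𝓝 (L g)] c := by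
      filter_upwards [h1, h2, hU] with y hy1 hy2 hy3
      have hy := hΛ _ hy1
      rw [← hcL _ _ hy g, hinj hy2 hy3 (hy.mem g).2]
    refine AnalyticAt.congr ?_ heq
    refine Finset.analyticAt_fun_prod _ fun h _ => ?_
    refine AnalyticAt.comp (g := ψ) (hψ.analyticOnNhd _ ?_) (hΛan' h)
    rw [hΛ0]
    exact (hL.mem h).1
  have hnorm : ∀ z ∈ disk \ F, ‖c z‖ ≤ 1 := by
    intro z hz
    obtain ⟨L, hL, g, rfl⟩ := hI.exists_marking_eq h0 hz.1 (hreg z hz)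
    rw [hcL _ _ hL, norm_prod]
    exact Finset.prod_le_one (fun h _ => norm_nonneg _)
      fun h _ => (mem_disk.1 (hψ.mapsTo (hL.mem h).1)).le
  obtain ⟨C, hCd, hCc⟩ := exists_differentiableOn_extension isOpen_disk hFfin
    (fun z hz => (han z hz).differentiableAt.differentiableWithinAt) hnorm
  have hLF : ∀ w L, IsMarking I w L → ∀ g, L g ∈ disk \ F := fun w L hL g =>
    ⟨(hL.mem g).1, fun h => hL.mem_regularValues.2 ((hL.mem g).2 ▸ h.2)⟩
  have hCL : ∀ w L, IsMarking I w L → ∀ g, C (L g) = ∏ h ∈ S g, ψ (L h) := fun w L hL g => by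
    rw [hCc (hLF w L hL g), hcL w L hL]
  have hFb : ∀ᶠ z in boundary, z ∈ disk \ F := by
    refine eventually_boundary_mem_disk.and ?_
    have : ∀ᶠ z in boundary, ∀ y ∈ F, z ≠ y := hFfin.eventually_all.2 fun y hy => by
      filter_upwards [eventually_boundary_lt_norm (mem_disk.1 hy.1)] with z hz
      rintro rfl
      exact lt_irrefl _ hz
    filter_upwards [this] with z hz hzF using hz z hzF rfl
  have hbd : Tendsto (fun z => ‖C z‖) boundary (𝓝 1) := by
    have := hI.finite_branch h0
    have := Fintype.ofFinite (Branch I)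
    refine tendsto_order.2 ⟨fun a ha => ?_, fun a ha => ?_⟩
    -- A product of at most `card (Branch I)` factors, each of modulus above `q`, then has modulus
    -- above `a`.
    · obtain ⟨q, ⟨hq, hq0⟩, hq1⟩ : ∃ q : ℝ, (a < q ^ Fintype.card (Branch I) ∧ 0 < q) ∧ q < 1 := by
        have h1 : ∀ᶠ q in 𝓝 (1 : ℝ), a < q ^ Fintype.card (Branch I) ∧ 0 < q :=
          ((continuous_pow _).continuousAt.eventually (lt_mem_nhds (by simpa using ha))).and
            (lt_mem_nhds one_pos)
        have h2 : ∀ᶠ q in 𝓝[<] (1 : ℝ), a < q ^ Fintype.card (Branch I) ∧ 0 < q :=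
          mem_nhdsWithin_of_mem_nhds h1
        have h3 : ∀ᶠ q in 𝓝[<] (1 : ℝ), q < 1 := eventually_mem_nhdsWithin
        exact (h2.and h3).exists
      obtain ⟨r, hr1, hr0, hr⟩ := eventually_boundary_iff.1
        (hψ.tendsto_norm.eventually (lt_mem_nhds hq1))
      obtain ⟨t, ht1, ht0, ht⟩ := hI.exists_lt_norm hr0.le hr1
      filter_upwards [hFb, hI.tendsto_norm.eventually (lt_mem_nhds ht1)] with z hz hzt
      obtain ⟨L, hL, g, rfl⟩ := hI.exists_marking_eq h0 hz.1 (hreg z hz)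
      rw [hCL _ _ hL, norm_prod]
      calc a < q ^ Fintype.card (Branch I) := hq
        _ ≤ q ^ (S g).card := pow_le_pow_of_le_one hq0.le hq1.le (Finset.card_le_univ _)
        _ = ∏ h ∈ S g, q := by simp
        _ ≤ _ := Finset.prod_le_prod (fun _ _ => hq0.le) fun h _ => by
          have hm := hL.mem h
          exact (hr _ hm.1 (ht _ hm.1 (by rw [hm.2]; exact hzt.le))).le
    · filter_upwards [hFb] with z hz
      rw [hCc hz]
      exact (hnorm z hz).trans_lt ha
  obtain ⟨z₀, hz₀, hIz₀⟩ := hI.surjOn zero_mem_disk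
  obtain ⟨g₀, -⟩ := hI.exists_branch h0 hz₀ hIz₀
  -- Excludes a unimodular constant; this is where the members of the family must be nonempty.
  have hlt : ‖C g₀.ev‖ < 1 := by
    have hmem : ∀ h : Branch I, ‖ψ h.ev‖ < 1 := fun h => mem_disk.1 (hψ.mapsTo h.ev_mem.1)
    obtain ⟨h, hh⟩ := hne g₀
    rw [hCL 0 _ (hI.isMarking_ev h0), norm_prod, ← Finset.mul_prod_erase _ _ hh]
    have h1 : ∏ k ∈ (S g₀).erase h, ‖ψ k.ev‖ ≤ 1 :=
      Finset.prod_le_one (fun _ _ => norm_nonneg _) fun k _ => (hmem k).le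
    calc _ ≤ ‖ψ h.ev‖ * 1 := by gcongr
      _ < 1 := by rw [mul_one]; exact hmem h
  obtain ⟨k, hk⟩ := exists_isBlaschke (hCd.analyticOnNhd isOpen_disk) hbd
    ⟨_, g₀.ev_mem.1, hlt⟩
  exact ⟨C, k, hk, hCL⟩

/-- A finite Blaschke product that is constant on the fibers of another one factors through it. -/
theorem IsBlaschke.exists_factor {k : ℕ} {C : ℂ → ℂ} (hI : IsBlaschke n I) (hC : IsBlaschke k C)
    (h : ∀ z ∈ disk, ∀ z' ∈ disk, C z = C z' → I z = I z') :
    ∃ (J : ℂ → ℂ) (m : ℕ), IsBlaschke m J ∧ EqOn I (J ∘ C) disk := by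
  classical
  have hs : ∀ v : ℂ, ∃ z, v ∈ disk → z ∈ disk ∧ C z = v := fun v => by
    by_cases hv : v ∈ disk
    · obtain ⟨z, hz, hz'⟩ := hC.surjOn hv
      exact ⟨z, fun _ => ⟨hz, hz'⟩⟩
    · exact ⟨0, fun h => absurd h hv⟩
  choose s hs using hs
  -- A set-theoretic section of `C` suffices: `J` is continuous because `C` is open, analytic at
  -- regular values through local inverses of `C`, and the finitely many critical values are then
  -- removable.
  set J : ℂ → ℂ := fun v => I (s v) with hJ
  have hJC : ∀ z ∈ disk, J (C z) = I z := fun z hz =>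
    h _ (hs _ (hC.mapsTo hz)).1 _ hz (hs _ (hC.mapsTo hz)).2
  have hcont : ∀ v ∈ disk, ContinuousAt J v := by
    intro v hv
    obtain ⟨z, hz, rfl⟩ := hC.surjOn hv
    intro O hO
    rw [hJC z hz] at hO
    have h1 : I ⁻¹' O ∩ disk ∈ 𝓝 z :=
      inter_mem ((hI.analyticOnNhd z hz).continuousAt hO) (isOpen_disk.mem_nhds hz)
    obtain ⟨V, hV, hVo, hzV⟩ := mem_nhds_iff.1 h1
    have h2 := (hC.isOpen_image hVo fun y hy => (hV hy).2).mem_nhds ⟨z, hzV, rfl⟩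
    refine mem_map.2 (mem_of_superset h2 ?_)
    rintro _ ⟨y, hy, rfl⟩
    change J (C y) ∈ O
    rw [hJC y (hV hy).2]
    exact (hV hy).1
  have hdiff : ∀ v ∈ regularValues C, DifferentiableAt ℂ J v := by
    intro v hv
    obtain ⟨z, hz, rfl⟩ := hC.surjOn hv.1
    obtain ⟨u, hu1, hu2, hu3, -⟩ := exists_localInverse (hC.analyticOnNhd z hz)
      (deriv_ne_zero_of_mem_regularValues hz hv)
    have h1 : ∀ᶠ w in 𝓝 (C z), u w ∈ disk :=
      hu1.continuousAt.eventually_mem (by rw [hu2]; exact isOpen_disk.mem_nhds hz)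
    have heq : J =ᶠ[𝓝 (C z)] I ∘ u := by
      filter_upwards [h1, hu3] with w hw hw'
      rw [Function.comp, ← hJC _ hw, hw']
    refine DifferentiableAt.congr_of_eventuallyEq ?_ heq
    refine DifferentiableAt.comp _ ?_ hu1.differentiableAt
    rw [hu2]
    exact (hI.analyticOnNhd z hz).differentiableAt
  have hJan : AnalyticOnNhd ℂ J disk := by
    intro v hv
    refine Complex.analyticAt_of_differentiable_on_punctured_nhds_of_continuousAt ?_ (hcont v hv)
    have h1 : disk \ (criticalValues C \ {v}) ∈ 𝓝 v :=
      (isOpen_disk.sdiff (hC.finite_criticalValues.subset sdiff_subset).isClosed).mem_nhds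
        ⟨hv, fun h => h.2 rfl⟩
    filter_upwards [mem_nhdsWithin_of_mem_nhds h1, self_mem_nhdsWithin] with w hw hwv
    exact hdiff w ⟨hw.1, fun h => hw.2 ⟨h, hwv⟩⟩
  have hlt : ∀ v ∈ disk, ‖J v‖ < 1 := fun v hv => mem_disk.1 (hI.mapsTo (hs v hv).1)
  have hbd : Tendsto (fun z => ‖J z‖) boundary (𝓝 1) := by
    refine tendsto_order.2 ⟨fun a ha => ?_, fun a ha => ?_⟩
    · obtain ⟨r, hr1, hr0, hr⟩ := eventually_boundary_iff.1
        (hI.tendsto_norm.eventually (lt_mem_nhds ha))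
      obtain ⟨t, ht1, ht0, ht⟩ := hC.exists_lt_norm hr0.le hr1
      filter_upwards [eventually_boundary_mem_disk, eventually_boundary_lt_norm ht1] with v hv hvt
      obtain ⟨h1, h2⟩ := hs v hv
      exact hr _ h1 (ht _ h1 (by rw [h2]; exact hvt.le))
    · filter_upwards [eventually_boundary_mem_disk] with v hv using (hlt v hv).trans ha
  obtain ⟨m, hm⟩ := exists_isBlaschke hJan hbd ⟨0, zero_mem_disk, hlt 0 zero_mem_disk⟩
  exact ⟨J, m, hm, fun z hz => (hJC z hz).symm⟩

/-- After moving `a` to `0` by an automorphism, Vieta's formula makes the product an automorphism of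
`v`. It vanishes at `v = 0` because `a` lies over `0`, so it is a rotation. -/
theorem IsBlaschke.exists_norm_prod_fiber_eq (hI : IsBlaschke n I)
    (h0 : (0 : ℂ) ∉ criticalValues I) {a : ℂ} (ha : a ∈ disk) (hIa : I a = 0) :
    ∀ v ∈ disk, ∀ S : Finset ℂ, (∀ z ∈ S, z ∈ disk ∧ I z = v) → S.card = n →
      ∏ z ∈ S, ‖blaschkeFactor a z‖ = ‖v‖ := by
  classical
  have hβ := isBlaschke_blaschkeFactor ha
  obtain ⟨χ, hχ, hχ1, hχ2⟩ := hβ.exists_inverse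
  obtain ⟨φ, hφ, hprod⟩ := (hI.comp_one hχ).exists_prod_fiber_eq
  have key : ∀ v ∈ disk, ∀ S : Finset ℂ, (∀ z ∈ S, z ∈ disk ∧ I z = v) → S.card = n →
      ∏ z ∈ S, blaschkeFactor a z = φ v := by
    intro v hv S hS hcard
    have hinj : InjOn (blaschkeFactor a) S := hβ.injOn.mono fun z hz => (hS z hz).1
    rw [← hprod v hv (S.image (blaschkeFactor a)) ?_ ?_, Finset.prod_image hinj]
    · intro y hy
      obtain ⟨z, hz, rfl⟩ := Finset.mem_image.1 hy
      refine ⟨hβ.mapsTo (hS z hz).1, ?_⟩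
      rw [Function.comp, hχ1 z (hS z hz).1]
      exact (hS z hz).2
    · rw [Finset.card_image_of_injOn hinj, hcard]
  obtain ⟨S₀, hS₀, hmem⟩ := hI.exists_fiber zero_mem_disk h0
  have hφ0 : φ 0 = 0 := by
    rw [← key 0 zero_mem_disk S₀ (fun z hz => (hmem z).1 hz) hS₀]
    exact Finset.prod_eq_zero ((hmem a).2 ⟨ha, hIa⟩) (blaschkeFactor_self a)
  obtain ⟨c, α, hc, hα, hφα⟩ := isBlaschke_one_iff.1 hφ
  have hα0 : α = 0 := by
    rw [hφα zero_mem_disk, mul_eq_zero, or_iff_right (norm_ne_zero_iff.1 (by simp [hc])),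
      blaschkeFactor_eq_zero_iff hα zero_mem_disk] at hφ0
    exact hφ0.symm
  intro v hv S hS hcard
  rw [← norm_prod, key v hv S hS hcard, hφα hv, hα0, norm_mul, hc]
  simp [blaschkeFactor]

end

/-! ### Factorizations and normal subgroups -/

section
variable {n m k : ℕ} {I J b : ℂ → ℂ}

/-- Normality enters here: it is what lets the whole monodromy group permute the `N`-orbits. -/
theorem mem_orbit_map_iff {N : Subgroup (monodromyGroup I)} (hN : N.Normal)
    {σ : Equiv.Perm (Branch I)} (hσ : σ ∈ monodromyGroup I) (g h : Branch I) :
    h ∈ MulAction.orbit N g ↔ σ h ∈ MulAction.orbit N (σ g) := by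
  have key : ∀ σ : monodromyGroup I, ∀ g h : Branch I, h ∈ MulAction.orbit N g →
      σ • h ∈ MulAction.orbit N (σ • g) := by
    rintro σ g _ ⟨ν, rfl⟩
    refine ⟨⟨σ * ν * σ⁻¹, hN.conj_mem ν ν.2 σ⟩, ?_⟩
    change (σ * (ν : monodromyGroup I) * σ⁻¹) • σ • g = σ • (ν : monodromyGroup I) • g
    rw [mul_smul, mul_smul, inv_smul_smul]
  refine ⟨key ⟨σ, hσ⟩ g h, fun hh => ?_⟩
  have := key (⟨σ, hσ⟩⁻¹) _ _ hh
  rwa [show σ h = (⟨σ, hσ⟩ : monodromyGroup I) • h from rfl,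
    show σ g = (⟨σ, hσ⟩ : monodromyGroup I) • g from rfl, inv_smul_smul, inv_smul_smul] at this

theorem LiftsTo.comp_left (hb : IsBlaschke k b) (heq : EqOn I (J ∘ b) disk) {v w x y : ℂ}
    {γ : Path v w} (h : LiftsTo I γ x y) : LiftsTo J γ (b x) (b y) := by
  obtain ⟨Γ, h⟩ := h
  have hcont : ContinuousOn b (range Γ) := by
    refine hb.analyticOnNhd.continuousOn.mono ?_
    rintro _ ⟨t, rfl⟩
    exact (h t).1
  exact ⟨Γ.map' hcont, fun t => ⟨hb.mapsTo (h t).1, (heq (h t).1).symm.trans (h t).2⟩⟩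

theorem IsBlaschke.regularValues_subset (hJ : IsBlaschke m J) (hb : IsBlaschke k b)
    (heq : EqOn I (J ∘ b) disk) : regularValues I ⊆ regularValues J :=
  fun _ hw => ⟨hw.1, fun h => hw.2 ((hJ.criticalValues_comp_left hb heq).1 h)⟩

theorem IsBlaschke.zero_notMem_criticalValues_left (hJ : IsBlaschke m J) (hb : IsBlaschke k b)
    (heq : EqOn I (J ∘ b) disk) (h0 : (0 : ℂ) ∉ criticalValues I) :
    (0 : ℂ) ∉ criticalValues J :=
  fun h => h0 ((hJ.criticalValues_comp_left hb heq).1 h)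

variable (hI : IsBlaschke n I) (h0 : (0 : ℂ) ∉ criticalValues I) (hJ : IsBlaschke m J)
  (hb : IsBlaschke k b) (heq : EqOn I (J ∘ b) disk)
include hI h0 hJ hb heq

/-- `b` sends lifts through `I` to lifts through `J`, and those are unique, so monodromy permutes
the classes of `b`. -/
theorem map_ev_eq_of_mem {σ : Equiv.Perm (Branch I)} (hσ : σ ∈ monodromyGroup I)
    {g h : Branch I} (hgh : b h.ev = b g.ev) : b (σ h).ev = b (σ g).ev := by
  obtain ⟨γ, hγ, hL⟩ := (hI.mem_monodromyGroup_iff h0).1 hσ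
  have h1 := (hL h).comp_left hb heq
  rw [hgh] at h1
  exact hJ.liftsTo_unique (fun t => hJ.regularValues_subset hb heq (hγ t)) h1
    ((hL g).comp_left hb heq)

omit hI in
-- Both `b ∘ g` and `b ∘ h` are local right inverses of `J` at the regular value `0`, hence
-- determined by their values there.
theorem germ_map_eq_iff {g h : Branch I} :
    Germ.map b h.1 = Germ.map b g.1 ↔ b h.ev = b g.ev := by
  obtain ⟨u, hu1, hu2, hu3, hu4⟩ := g.exists_rep
  obtain ⟨v, hv1, hv2, hv3, hv4⟩ := h.exists_rep
  rw [← hu3, ← hv3, Germ.map_coe, Germ.map_coe, Germ.coe_eq, ← hu4, ← hv4]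
  constructor
  · intro h
    exact h.self_of_nhds
  · intro h
    refine hJ.eventuallyEq_of_rightInverse (w := 0)
      ⟨zero_mem_disk, hJ.zero_notMem_criticalValues_left hb heq h0⟩ ?_ ?_
      (hb.mapsTo hv2.self_of_nhds.1) h
      (hv2.mono fun w hw => (heq hw.1).symm.trans hw.2)
      (hu2.mono fun w hw => (heq hw.1).symm.trans hw.2)
    · exact (hb.analyticOnNhd _ hv2.self_of_nhds.1).continuousAt.comp hv1.continuousAt
    · exact (hb.analyticOnNhd _ hu2.self_of_nhds.1).continuousAt.comp hu1.continuousAt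

omit hI in
theorem mem_factorSubgroup_iff {σ : monodromyGroup I} :
    σ ∈ factorSubgroup I b ↔ ∀ g : Branch I, b (σ.1 g).ev = b g.ev := by
  exact forall_congr' fun g => germ_map_eq_iff h0 hJ hb heq

theorem normal_factorSubgroup : (factorSubgroup I b).Normal := by
  refine ⟨fun σ hσ τ => ?_⟩
  rw [mem_factorSubgroup_iff h0 hJ hb heq] at hσ ⊢
  intro g
  have := map_ev_eq_of_mem hI h0 hJ hb heq τ.2 (hσ (τ.1⁻¹ g))
  rw [← Equiv.Perm.mul_apply τ.1 (τ.1⁻¹), mul_inv_cancel, Equiv.Perm.one_apply] at this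
  exact this

omit hI in
theorem associated_iff {N : Subgroup (monodromyGroup I)} : Associated N b ↔
    ∀ g h : Branch I, h ∈ MulAction.orbit N g ↔ b h.ev = b g.ev := by
  exact forall₂_congr fun g h => by rw [germ_map_eq_iff h0 hJ hb heq]

/-- The point is transitivity on each class. Write `h = τ ^ j g` with the transitive `τ`. Every
branch is `τ ^ i g`, and `τ ^ j` sends it to `τ ^ i h`, which is in the same class because `τ ^ i`
permutes classes. -/
theorem associated_factorSubgroup : Associated (factorSubgroup I b) b := by
  rw [associated_iff h0 hJ hb heq]
  intro g h
  constructor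
  · rintro ⟨σ, rfl⟩
    exact (mem_factorSubgroup_iff h0 hJ hb heq).1 σ.2 g
  · intro hgh
    obtain ⟨τ, hτ, htrans⟩ := hI.exists_transitive_cyclic h0
    obtain ⟨j, hj⟩ := htrans g h
    refine ⟨⟨⟨τ ^ j, zpow_mem hτ j⟩, ?_⟩, hj⟩
    rw [mem_factorSubgroup_iff h0 hJ hb heq]
    intro y
    obtain ⟨i, rfl⟩ := htrans g y
    have h1 := map_ev_eq_of_mem hI h0 hJ hb heq (zpow_mem hτ i) hgh
    rw [← Equiv.Perm.mul_apply, ← zpow_add, add_comm, zpow_add, Equiv.Perm.mul_apply, hj, h1]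

theorem exists_fiber_branches (g : Branch I) :
    ∃ S : Finset (Branch I), S.card = k ∧ ∀ h, h ∈ S ↔ b h.ev = b g.ev := by
  classical
  have := hI.finite_branch h0
  have := Fintype.ofFinite (Branch I)
  have hnc : b g.ev ∉ criticalValues b := by
    rintro ⟨z, hz, hz', hzg⟩
    refine h0 ?_
    have := (hJ.criticalValues_comp_left hb heq).2 z hz hz'
    rwa [heq hz, Function.comp, hzg, ← Function.comp_apply (f := J), ← heq g.ev_mem.1,
      g.ev_mem.2] at this
  obtain ⟨S, hS, hmem⟩ := hb.exists_fiber (hb.mapsTo g.ev_mem.1) hnc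
  refine ⟨Finset.univ.filter fun h => b h.ev = b g.ev, ?_, by simp⟩
  rw [← hS, ← Finset.card_image_of_injective _ (hI.ev_injective h0)]
  congr 1
  ext z
  simp only [Finset.mem_image, Finset.mem_filter, Finset.mem_univ, true_and, hmem]
  constructor
  · rintro ⟨h, hh, rfl⟩
    exact ⟨h.ev_mem.1, hh⟩
  · rintro ⟨hz, hzg⟩
    obtain ⟨h, rfl⟩ := hI.exists_branch h0 hz (by
      rw [heq hz, Function.comp, hzg, ← Function.comp_apply (f := J), ← heq g.ev_mem.1, g.ev_mem.2])
    exact ⟨h, hzg, rfl⟩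

/-- The products over the orbits are given by the right factor, up to an automorphism. -/
theorem exists_isOrbitProduct {N : Subgroup (monodromyGroup I)} (hN : Associated N b) :
    ∃ φ : ℂ → ℂ, IsBlaschke 1 φ ∧ IsOrbitProduct N (φ ∘ b) := by
  classical
  obtain ⟨φ, hφ, hprod⟩ := hb.exists_prod_fiber_eq
  refine ⟨φ, hφ, fun g => ?_⟩
  have hN' := (associated_iff h0 hJ hb heq).1 hN
  obtain ⟨S, hS, hmem⟩ := exists_fiber_branches hI h0 hJ hb heq g
  have horb : MulAction.orbit N g = (S : Set (Branch I)) := by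
    ext h
    rw [hN', Finset.mem_coe, hmem]
  choose u hu1 hu2 hu3 hu4 using fun h : Branch I => h.exists_rep
  rw [horb, finprod_mem_coe_finset]
  have hgerm : ∏ h ∈ S, h.1 = ((fun w => ∏ h ∈ S, u h w : ℂ → ℂ) : Germ (𝓝 (0 : ℂ)) ℂ) := by
    have := map_prod (Germ.coeMulHom (M := ℂ) (𝓝 (0 : ℂ))) u S
    simp only [Germ.coe_coeMulHom, hu3] at this
    rw [← this]
    congr 1
    ext w
    simp
  rw [hgerm, ← hu3 g, Germ.map_coe, Germ.coe_eq]
  -- Near `0` the values of the branches in the class are `k` distinct points of one fiber of `b`,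
  -- so Vieta's formula for `b` evaluates their product.
  have h1 : ∀ᶠ w in 𝓝 (0 : ℂ), ∀ h ∈ S, (u h w ∈ disk ∧ b (u h w) = b (u g w)) ∧
      ∀ h' ∈ S, h ≠ h' → u h w ≠ u h' w := by
    refine (Finset.eventually_all S).2 fun h hh => Eventually.and ((hu2 h).mono fun _ hw => hw.1) ?_ |>.and ((Finset.eventually_all S).2 fun h' hh' => ?_)
    · have := (germ_map_eq_iff h0 hJ hb heq).2 ((hmem h).1 hh)
      rw [← hu3 g, ← hu3 h, Germ.map_coe, Germ.map_coe, Germ.coe_eq] at this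
      exact this
    · by_cases hne : h = h'
      · exact Eventually.of_forall fun w hw => absurd hne hw
      · have hne' : u h 0 ≠ u h' 0 := by
          rw [hu4, hu4]
          exact fun he => hne (hI.ev_injective h0 he)
        have := ((hu1 h).continuousAt.sub (hu1 h').continuousAt).eventually_ne
          (sub_ne_zero.2 hne')
        exact this.mono fun w hw _ => sub_ne_zero.1 hw
  filter_upwards [h1, hu2 g] with w hw hg
  have hinj : InjOn (fun h => u h w) S := by
    intro h hh h' hh' he
    by_contra hne
    exact (hw h hh).2 h' hh' hne he
  rw [Function.comp, Function.comp, ← hprod _ (hb.mapsTo hg.1) (S.image fun h => u h w) ?_ ?_,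
    Finset.prod_image hinj]
  · intro z hz
    obtain ⟨h, hh, rfl⟩ := Finset.mem_image.1 hz
    exact (hw h hh).1
  · rw [Finset.card_image_of_injOn hinj, hS]

omit hI h0 in
/-- Changing a factorization by an automorphism of the disk. -/
theorem exists_equivalent_factorization {φ : ℂ → ℂ} (hφ : IsBlaschke 1 φ) :
    ∃ (J' : ℂ → ℂ) (m' k' : ℕ), IsBlaschke m' J' ∧ IsBlaschke k' (φ ∘ b) ∧
      EqOn I (J' ∘ (φ ∘ b)) disk ∧ EqOn J (J' ∘ φ) disk := by
  obtain ⟨χ, hχ, hχ1, -⟩ := hφ.exists_inverse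
  obtain ⟨k', hk'⟩ := hφ.comp hb
  refine ⟨J ∘ χ, m, k', hJ.comp_one hχ, hk', fun z hz => ?_, fun z hz => ?_⟩
  · simp only [Function.comp, hχ1 _ (hb.mapsTo hz)]
    exact heq hz
  · simp only [Function.comp, hχ1 _ hz]

/-- Two factorizations associated with the same subgroup are equivalent. -/
theorem equivalentFactorizations_of_associated {m' k' : ℕ} {J' b' : ℂ → ℂ}
    (hJ' : IsBlaschke m' J') (hb' : IsBlaschke k' b') (heq' : EqOn I (J' ∘ b') disk)
    {N : Subgroup (monodromyGroup I)} (hN : Associated N b) (hN' : Associated N b') :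
    EquivalentFactorizations J b J' b' := by
  obtain ⟨φ, hφ, hφN⟩ := exists_isOrbitProduct hI h0 hJ hb heq hN
  obtain ⟨φ', hφ', hφN'⟩ := exists_isOrbitProduct hI h0 hJ' hb' heq' hN'
  obtain ⟨χ, hχ, hχ1, -⟩ := hφ'.exists_inverse
  obtain ⟨z₀, hz₀, hIz₀⟩ := hI.surjOn zero_mem_disk
  obtain ⟨g, hg⟩ := hI.exists_branch h0 hz₀ hIz₀
  obtain ⟨u, hu1, hu2, hu3, hu4⟩ := g.exists_rep
  -- Both sides are the same orbit product. As `u` inverts `I` near `z₀`, the functions agree near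
  -- `z₀`, hence on the disk.
  have h1 : (φ ∘ b) ∘ u =ᶠ[𝓝 0] (φ' ∘ b') ∘ u := by
    have := (hφN g).trans (hφN' g).symm
    rwa [← hu3, Germ.map_coe, Germ.map_coe, Germ.coe_eq] at this
  have h2 : φ ∘ b =ᶠ[𝓝 z₀] φ' ∘ b' := by
    have hIc := (hI.analyticOnNhd z₀ hz₀).continuousAt
    obtain ⟨U, hU, hinj⟩ := hI.eventually_injOn hz₀ fun h => h0 ⟨z₀, hz₀, h, hIz₀⟩
    have hIc' : Tendsto I (𝓝 z₀) (𝓝 0) := hIz₀ ▸ hIc.tendsto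
    have h3 : ∀ᶠ w in 𝓝 (0 : ℂ), u w ∈ U :=
      hu1.continuousAt.eventually_mem (by rwa [hu4, hg])
    filter_upwards [hIc'.eventually h1, hIc'.eventually hu2, hIc'.eventually h3, hU]
      with z hz1 hz2 hz3 hz4
    have hz : u (I z) = z := hinj hz3 hz4 hz2.2
    simpa only [Function.comp, hz] using hz1
  have h3 : EqOn (φ ∘ b) (φ' ∘ b') disk :=
    AnalyticOnNhd.eqOn_of_preconnected_of_eventuallyEq
      (hφ.analyticOnNhd.comp hb.analyticOnNhd hb.mapsTo)
      (hφ'.analyticOnNhd.comp hb'.analyticOnNhd hb'.mapsTo) isPreconnected_disk hz₀ h2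
  have h4 : EqOn b' ((χ ∘ φ) ∘ b) disk := by
    intro z hz
    have := h3 hz
    simp only [Function.comp] at this ⊢
    rw [this, hχ1 _ (hb'.mapsTo hz)]
  refine ⟨χ ∘ φ, hχ.comp_one hφ, h4, fun v hv => ?_⟩
  obtain ⟨z, hz, rfl⟩ := hb.surjOn hv
  have h5 := h4 hz
  simp only [Function.comp] at h5 ⊢
  rw [← h5]
  exact (heq hz).symm.trans (heq' hz)

omit hI in
theorem factorSubgroup_eq_of_equivalent {m' k' : ℕ} {J' b' : ℂ → ℂ}
    (hJ' : IsBlaschke m' J') (hb' : IsBlaschke k' b') (heq' : EqOn I (J' ∘ b') disk)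
    (h : EquivalentFactorizations J b J' b') : factorSubgroup I b = factorSubgroup I b' := by
  obtain ⟨φ, hφ, hφb, -⟩ := h
  ext σ
  rw [mem_factorSubgroup_iff h0 hJ hb heq, mem_factorSubgroup_iff h0 hJ' hb' heq']
  refine forall_congr' fun g => ?_
  rw [hφb (σ.1 g).ev_mem.1, hφb g.ev_mem.1]
  exact (hφ.injOn.eq_iff (hb.mapsTo (σ.1 g).ev_mem.1) (hb.mapsTo g.ev_mem.1)).symm

/-- Classes have `k` elements and are orbits, so `k > 1` gives an element that moves a branch. -/
theorem factorSubgroup_ne_bot (hk : 1 < k) : factorSubgroup I b ≠ ⊥ := by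
  intro hbot
  obtain ⟨z₀, hz₀, hIz₀⟩ := hI.surjOn zero_mem_disk
  obtain ⟨g, -⟩ := hI.exists_branch h0 hz₀ hIz₀
  obtain ⟨S, hS, hmem⟩ := exists_fiber_branches hI h0 hJ hb heq g
  obtain ⟨h, hh, hne⟩ := Finset.exists_mem_ne (hS ▸ hk) g
  obtain ⟨σ, hσ⟩ := ((associated_iff h0 hJ hb heq).1
    (associated_factorSubgroup hI h0 hJ hb heq) g h).2 ((hmem h).1 hh)
  have h1 : (σ : monodromyGroup I) = 1 := by
    rw [← Subgroup.mem_bot, ← hbot]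
    exact σ.2
  apply hne
  rw [← hσ]
  change (σ : monodromyGroup I) • g = g
  rw [h1, one_smul]

/-- There are `m > 1` classes, one for each point of `J⁻¹(0)`, and the group is transitive on
branches. -/
theorem factorSubgroup_ne_top (hm : 1 < m) : factorSubgroup I b ≠ ⊤ := by
  intro htop
  obtain ⟨S, hS, hmem⟩ := hJ.exists_fiber zero_mem_disk
    (hJ.zero_notMem_criticalValues_left hb heq h0)
  obtain ⟨y, hy, y', hy', hne⟩ := Finset.one_lt_card.1 (hS ▸ hm)
  have hex : ∀ y ∈ S, ∃ g : Branch I, b g.ev = y := by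
    intro y hy
    obtain ⟨hyd, hJy⟩ := (hmem y).1 hy
    obtain ⟨z, hz, rfl⟩ := hb.surjOn hyd
    obtain ⟨g, rfl⟩ := hI.exists_branch h0 hz ((heq hz).trans hJy)
    exact ⟨g, rfl⟩
  obtain ⟨g, rfl⟩ := hex y hy
  obtain ⟨h, rfl⟩ := hex y' hy'
  obtain ⟨τ, hτ, htrans⟩ := hI.exists_transitive_cyclic h0
  obtain ⟨j, hj⟩ := htrans g h
  have h1 : (⟨τ ^ j, zpow_mem hτ j⟩ : monodromyGroup I) ∈ factorSubgroup I b := by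
    rw [htop]
    trivial
  have h2 := (mem_factorSubgroup_iff h0 hJ hb heq).1 h1 g
  rw [hj] at h2
  exact hne h2.symm

end

/-- Every normal subgroup is associated with a factorization. -/
theorem IsBlaschke.exists_associated {n : ℕ} {I : ℂ → ℂ} (hI : IsBlaschke n I)
    (h0 : (0 : ℂ) ∉ criticalValues I) {N : Subgroup (monodromyGroup I)} (hN : N.Normal) :
    ∃ (J C : ℂ → ℂ) (m k : ℕ), IsBlaschke m J ∧ IsBlaschke k C ∧ EqOn I (J ∘ C) disk ∧
      Associated N C := by
  classical
  have := hI.finite_branch h0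
  have := Fintype.ofFinite (Branch I)
  obtain ⟨a, ha, hIa⟩ := hI.surjOn zero_mem_disk
  obtain ⟨g₀, hg₀⟩ := hI.exists_branch h0 ha hIa
  set S : Branch I → Finset (Branch I) :=
    fun g => Finset.univ.filter fun h => h ∈ MulAction.orbit N g with hS
  have hmemS : ∀ g h, h ∈ S g ↔ h ∈ MulAction.orbit N g := by simp [hS]
  have hSself : ∀ g, g ∈ S g := fun g => (hmemS g g).2 (MulAction.mem_orbit_self g)
  have hSsymm : ∀ g h, h ∈ S g → g ∈ S h := fun g h hh => by
    rw [hmemS] at hh ⊢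
    exact MulAction.mem_orbit_symm.1 hh
  have hSeq : ∀ g h, h ∈ S g → S h = S g := fun g h hh => by
    ext y
    rw [hmemS, hmemS, MulAction.orbit_eq_iff.2 ((hmemS g h).1 hh)]
  have hSinv : ∀ σ ∈ monodromyGroup I, ∀ g h, h ∈ S g ↔ σ h ∈ S (σ g) := fun σ hσ g h => by
    rw [hmemS, hmemS]
    exact mem_orbit_map_iff hN hσ g h
  -- Using the Blaschke factor at the zero `a` of `I` makes `C` vanish precisely on the orbit of the
  -- branch through `a`.
  obtain ⟨C, k, hC, hCL⟩ := hI.exists_prod_family h0 (isBlaschke_blaschkeFactor ha) S hSinv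
    fun g => ⟨g, hSself g⟩
  have hScard : ∀ g, (S g).card = (S g₀).card := by
    intro g
    obtain ⟨τ, hτ, htrans⟩ := hI.exists_transitive_cyclic h0
    obtain ⟨j, rfl⟩ := htrans g₀ g
    exact (Finset.card_equiv (τ ^ j) fun h => hSinv _ (zpow_mem hτ j) g₀ h).symm
  have hFfin := hI.finite_preimage_criticalValues
  set F : Set ℂ := {z | z ∈ disk ∧ I z ∈ criticalValues I} with hF
  have hreg : ∀ z ∈ disk \ F, I z ∈ regularValues I := fun z hz =>
    ⟨hI.mapsTo hz.1, fun h => hz.2 ⟨hz.1, h⟩⟩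
  -- `|I z|` is the product over the whole fiber and `|C z|` the product over an orbit; the omitted
  -- factors have modulus less than `1`.
  have hle' : ∀ z ∈ disk \ F, ‖I z‖ ≤ ‖C z‖ := by
    intro z hz
    obtain ⟨L, hL, g, rfl⟩ := hI.exists_marking_eq h0 hz.1 (hreg z hz)
    have hinj := hI.marking_injective h0 hL
    have himage : (Finset.univ.image L).card = n := by
      obtain ⟨T, hT, hmem⟩ := hI.exists_fiber hL.mem_regularValues.1 hL.mem_regularValues.2
      rw [← hT]
      congr 1
      ext y
      rw [hmem]
      constructor
      · intro hy
        obtain ⟨h, -, rfl⟩ := Finset.mem_image.1 hy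
        exact hL.mem h
      · intro hy
        obtain ⟨h, rfl⟩ := hI.marking_surjective h0 hL hy.1 hy.2
        exact Finset.mem_image_of_mem _ (Finset.mem_univ h)
    have h1 := hI.exists_norm_prod_fiber_eq h0 ha hIa _ (hI.mapsTo hz.1) (Finset.univ.image L)
      (fun y hy => by
        obtain ⟨h, -, rfl⟩ := Finset.mem_image.1 hy
        exact hL.mem h) himage
    rw [Finset.prod_image hinj.injOn] at h1
    rw [hCL _ _ hL, ← h1, norm_prod, ← Finset.prod_sdiff (Finset.subset_univ (S g))]
    refine mul_le_of_le_one_left (Finset.prod_nonneg fun _ _ => norm_nonneg _) ?_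
    exact Finset.prod_le_one (fun _ _ => norm_nonneg _)
      fun h _ => (mem_disk.1 (blaschkeFactor_mem_disk ha (hL.mem h).1)).le
  have hle : ∀ z ∈ disk, ‖I z‖ ≤ ‖C z‖ := by
    intro z hz
    have h1 : ∀ᶠ y in 𝓝[≠] z, ‖I y‖ ≤ ‖C y‖ := by
      have h2 : disk \ (F \ {z}) ∈ 𝓝 z :=
        (isOpen_disk.sdiff (hFfin.subset sdiff_subset).isClosed).mem_nhds ⟨hz, fun h => h.2 rfl⟩
      filter_upwards [mem_nhdsWithin_of_mem_nhds h2, self_mem_nhdsWithin] with y hy hyz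
      exact hle' y ⟨hy.1, fun h => hy.2 ⟨h, hyz⟩⟩
    exact le_of_tendsto_of_tendsto
      ((hI.analyticOnNhd z hz).continuousAt.norm.tendsto.mono_left nhdsWithin_le_nhds)
      ((hC.analyticOnNhd z hz).continuousAt.norm.tendsto.mono_left nhdsWithin_le_nhds) h1
  have hev := hI.isMarking_ev h0
  have hzero : ∀ z, (z ∈ disk ∧ C z = 0) ↔ ∃ g ∈ S g₀, g.ev = z := by
    intro z
    constructor
    · rintro ⟨hz, hCz⟩
      have hIz : I z = 0 := norm_le_zero_iff.1 (by simpa [hCz] using hle z hz)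
      obtain ⟨g, rfl⟩ := hI.exists_branch h0 hz hIz
      rw [hCL 0 _ hev, Finset.prod_eq_zero_iff] at hCz
      obtain ⟨h, hh, hh0⟩ := hCz
      rw [blaschkeFactor_eq_zero_iff ha h.ev_mem.1, ← hg₀] at hh0
      have := hI.ev_injective h0 hh0
      subst this
      exact ⟨g, hSsymm _ _ hh, rfl⟩
    · rintro ⟨g, hg, rfl⟩
      refine ⟨g.ev_mem.1, ?_⟩
      rw [hCL 0 _ hev]
      refine Finset.prod_eq_zero (hSsymm _ _ hg) ?_
      rw [hg₀, blaschkeFactor_self]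
  -- A multiple zero of `C` would be one of `I`, since `I = O(C)` there. So the order `k` of `C` is
  -- its number of zeros, the size of an orbit.
  have hC0 : (0 : ℂ) ∉ criticalValues C := by
    rintro ⟨z, hz, hz', hCz⟩
    have hIz : I z = 0 := norm_le_zero_iff.1 (by simpa [hCz] using hle z hz)
    have h1 : HasDerivAt C 0 z := hz' ▸ (hC.analyticOnNhd z hz).differentiableAt.hasDerivAt
    have h2 : HasDerivAt I 0 z := by
      rw [hasDerivAt_iff_isLittleO] at h1 ⊢
      simp only [hCz, hIz, sub_zero, smul_zero] at h1 ⊢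
      refine Asymptotics.IsBigO.trans_isLittleO (Asymptotics.IsBigO.of_bound 1 ?_) h1
      filter_upwards [isOpen_disk.mem_nhds hz] with y hy
      rw [one_mul]
      exact hle y hy
    exact h0 ⟨z, hz, h2.deriv, hIz⟩
  have hk : (S g₀).card = k := by
    obtain ⟨T, hT, hmem⟩ := hC.exists_fiber zero_mem_disk hC0
    rw [← hT, ← Finset.card_image_of_injective _ (hI.ev_injective h0)]
    congr 1
    ext z
    rw [hmem, hzero, Finset.mem_image]
  have hconst : ∀ w L, IsMarking I w L → ∀ g, ∀ h ∈ S g, C (L h) = C (L g) := by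
    intro w L hL g h hh
    rw [hCL _ _ hL, hCL _ _ hL, hSeq g h hh]
  -- An orbit already supplies `k` points of the fiber of `C`, and a fiber has at most `k`.
  have hfib : ∀ w L, IsMarking I w L → ∀ g, ∀ z ∈ disk, C z = C (L g) → ∃ h ∈ S g, L h = z := by
    intro w L hL g z hz hzg
    by_contra hcon
    push Not at hcon
    have hinj := hI.marking_injective h0 hL
    have hnot : z ∉ (S g).image L := by
      intro hmem
      obtain ⟨h, hh, hh'⟩ := Finset.mem_image.1 hmem
      exact hcon h hh hh'
    have hcard := hC.card_le_of_fiber (v := C (L g)) (S := insert z ((S g).image L))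
      (hC.mapsTo (hL.mem g).1) (by
        intro y hy
        rcases Finset.mem_insert.1 hy with rfl | hy
        · exact ⟨hz, hzg⟩
        · obtain ⟨h, hh, rfl⟩ := Finset.mem_image.1 hy
          exact ⟨(hL.mem h).1, hconst w L hL g h hh⟩)
    rw [Finset.card_insert_of_notMem hnot, Finset.card_image_of_injective _ hinj, hScard, hk]
      at hcard
    omega
  have hfactor' : ∀ z ∈ disk \ F, ∀ z' ∈ disk, C z = C z' → I z = I z' := by
    intro z hz z' hz' hzz'
    obtain ⟨L, hL, g, rfl⟩ := hI.exists_marking_eq h0 hz.1 (hreg z hz)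
    obtain ⟨h, -, rfl⟩ := hfib _ L hL g z' hz' hzz'.symm
    exact (hL.mem h).2.symm
  -- At the finitely many points of `F`: if `I z ≠ I z'`, openness of `C` gives nearby points with
  -- equal `C`-values and different `I`-values, outside `F`.
  have hfactor : ∀ z ∈ disk, ∀ z' ∈ disk, C z = C z' → I z = I z' := by
    intro z hz z' hz' hzz'
    by_contra hne
    obtain ⟨O, O', hO, hO', hzO, hzO', hdisj⟩ := t2_separation hne
    have hopen : ∀ y ∈ disk, ∀ V, IsOpen V → I y ∈ V → C '' (I ⁻¹' V ∩ disk) ∈ 𝓝 (C y) := by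
      intro y hy V hV hyV
      have h1 : I ⁻¹' V ∩ disk ∈ 𝓝 y :=
        inter_mem ((hI.analyticOnNhd y hy).continuousAt (hV.mem_nhds hyV))
          (isOpen_disk.mem_nhds hy)
      obtain ⟨W, hW, hWo, hyW⟩ := mem_nhds_iff.1 h1
      exact mem_of_superset ((hC.isOpen_image hWo fun x hx => (hW hx).2).mem_nhds ⟨y, hyW, rfl⟩)
        (image_mono hW)
    have h1 := hopen z hz O hO hzO
    have h2 := hopen z' hz' O' hO' hzO'
    rw [← hzz'] at h2
    have h3 : ∀ᶠ v in 𝓝[≠] (C z), v ∉ C '' F := by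
      have := ((hFfin.image C).subset (sdiff_subset (t := {C z}))).isClosed.isOpen_compl.mem_nhds
        (fun h => h.2 rfl : C z ∈ ((C '' F) \ {C z})ᶜ)
      filter_upwards [mem_nhdsWithin_of_mem_nhds this, self_mem_nhdsWithin] with v hv hv' h
        using hv ⟨h, hv'⟩
    have h4 : ∀ᶠ v in 𝓝[≠] (C z), v ∈ C '' (I ⁻¹' O ∩ disk) ∩ C '' (I ⁻¹' O' ∩ disk) :=
      mem_nhdsWithin_of_mem_nhds (inter_mem h1 h2)
    obtain ⟨v, ⟨⟨y, ⟨hyO, hy⟩, rfl⟩, y', ⟨hyO', hy'⟩, hyy'⟩, hvF⟩ :=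
      (h4.and h3).exists
    have := hfactor' y ⟨hy, fun h => hvF ⟨y, h, rfl⟩⟩ y' hy' hyy'.symm
    exact disjoint_left.1 hdisj hyO (this ▸ hyO')
  obtain ⟨J, m, hJ, hJC⟩ := hI.exists_factor hC hfactor
  refine ⟨J, C, m, k, hJ, hC, hJC, ?_⟩
  rw [associated_iff h0 hJ hC hJC]
  intro g h
  rw [← hmemS]
  constructor
  · exact hconst 0 _ hev g h
  · intro hgh
    obtain ⟨h', hh', he⟩ := hfib 0 _ hev g h.ev h.ev_mem.1 hgh
    rwa [← hI.ev_injective h0 he]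

/-! ### A normal subgroup associated with a trivial factorization -/

/-- The odd permutations of three letters are the transpositions. Hence the transitive `τ`, which
has no fixed point, is even. -/
theorem sign_eq_one_or_exists_fixed {α : Type*} [Fintype α] [DecidableEq α]
    (h : Fintype.card α = 3) (τ : Equiv.Perm α) :
    Equiv.Perm.sign τ = 1 ∨ ∃ x, τ x = x := by
  let e : α ≃ Fin 3 := Fintype.equivFinOfCardEq h
  have key : ∀ π : Equiv.Perm (Fin 3), Equiv.Perm.sign π = 1 ∨ ∃ x, π x = x := by decide
  rcases key (e.permCongr τ) with h1 | ⟨x, hx⟩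
  · rw [Equiv.Perm.sign_permCongr] at h1
    exact Or.inl h1
  · refine Or.inr ⟨e.symm x, e.injective ?_⟩
    simpa using hx

theorem even_perm_of_card_eq_three {α : Type*} [Fintype α] [DecidableEq α]
    (h : Fintype.card α = 3) {σ τ : Equiv.Perm α} (hσ : Equiv.Perm.sign σ = 1)
    (hτ : Equiv.Perm.sign τ = 1) : (∀ x, σ (τ x) = τ (σ x)) ∧ ∀ x, τ (τ (τ x)) = x := by
  let e : α ≃ Fin 3 := Fintype.equivFinOfCardEq h
  have key : ∀ π ρ : Equiv.Perm (Fin 3), Equiv.Perm.sign π = 1 → Equiv.Perm.sign ρ = 1 →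
      (∀ x, π (ρ x) = ρ (π x)) ∧ ∀ x, ρ (ρ (ρ x)) = x := by decide
  obtain ⟨h1, h2⟩ := key (e.permCongr σ) (e.permCongr τ)
    (by rw [Equiv.Perm.sign_permCongr, hσ]) (by rw [Equiv.Perm.sign_permCongr, hτ])
  refine ⟨fun x => e.injective ?_, fun x => e.injective ?_⟩
  · simpa using h1 (e x)
  · simpa using h2 (e x)

/-- If all monodromy permutations of a product of order three are even, then a fiber consisting of
two points contains no simple point. -/
theorem IsBlaschke.deriv_eq_zero_of_sign_eq_one {I : ℂ → ℂ} (hI : IsBlaschke 3 I)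
    (h0 : (0 : ℂ) ∉ criticalValues I) [Fintype (Branch I)] [DecidableEq (Branch I)]
    (hcard : Fintype.card (Branch I) = 3)
    (hsign : ∀ σ ∈ monodromyGroup I, Equiv.Perm.sign σ = 1) {z₀ z₁ : ℂ} (hz₁ : z₁ ∈ disk)
    (hne : z₀ ≠ z₁) (hz₀ : z₀ ∈ disk) (h01 : I z₀ = I z₁)
    (hfib : ∀ z ∈ disk, I z = I z₁ → z = z₀ ∨ z = z₁) : deriv I z₁ = 0 := by
  by_contra hd
  obtain ⟨τ, hτ, htrans⟩ := hI.exists_transitive_cyclic h0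
  have hcomm : ∀ σ ∈ monodromyGroup I, (∀ g, σ (τ g) = τ (σ g)) ∧ ∀ g, τ (τ (τ g)) = g :=
    fun σ hσ => even_perm_of_card_eq_three hcard (hsign σ hσ) (hsign τ hτ)
  -- The even permutations of three letters commute, so the singletons `{τ g}` form an invariant
  -- family, and `C` is a deck transformation of `I` inducing `τ`.
  obtain ⟨C, k, hC, hCL⟩ := hI.exists_prod_family h0 (isBlaschke_blaschkeFactor zero_mem_disk)
    (fun g => {τ g}) (fun σ hσ g h => by
      rw [Finset.mem_singleton, Finset.mem_singleton, ← (hcomm σ hσ).1 g]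
      exact σ.injective.eq_iff.symm) fun g => Finset.singleton_nonempty _
  have hCL' : ∀ w L, IsMarking I w L → ∀ g, C (L g) = L (τ g) := fun w L hL g => by
    rw [hCL w L hL, Finset.prod_singleton]
    simp [blaschkeFactor]
  obtain ⟨a, ha, hIa⟩ := hI.surjOn zero_mem_disk
  have hnear : ∀ᶠ z in 𝓝 a, z ∈ disk ∧ I z ∈ regularValues I :=
    (isOpen_disk.mem_nhds ha |> Filter.eventually_mem_set.2).and
      ((hI.analyticOnNhd a ha).continuousAt.eventually_mem
        (hI.isOpen_regularValues.mem_nhds (hIa ▸ ⟨zero_mem_disk, h0⟩)))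
  have hIC : EqOn (I ∘ C) I disk := by
    refine AnalyticOnNhd.eqOn_of_preconnected_of_eventuallyEq
      (hI.analyticOnNhd.comp hC.analyticOnNhd hC.mapsTo) hI.analyticOnNhd isPreconnected_disk ha ?_
    filter_upwards [hnear] with z hz
    obtain ⟨L, hL, g, rfl⟩ := hI.exists_marking_eq h0 hz.1 hz.2
    rw [Function.comp, hCL' _ _ hL]
    exact (hL.mem _).2
  have hCCC : EqOn (C ∘ C ∘ C) id disk := by
    refine AnalyticOnNhd.eqOn_of_preconnected_of_eventuallyEq
      (hC.analyticOnNhd.comp (hC.analyticOnNhd.comp hC.analyticOnNhd hC.mapsTo)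
        (hC.mapsTo.comp hC.mapsTo)) analyticOnNhd_id isPreconnected_disk ha ?_
    filter_upwards [hnear] with z hz
    obtain ⟨L, hL, g, rfl⟩ := hI.exists_marking_eq h0 hz.1 hz.2
    simp only [Function.comp, hCL' _ _ hL, id]
    rw [(hcomm 1 (one_mem _)).2]
  -- `C` maps the two-point fiber to itself and has cube the identity, so it fixes both points.
  have hC1 : C z₁ = z₁ := by
    have h1 := hfib _ (hC.mapsTo hz₁) (hIC hz₁)
    have h2 := hfib _ (hC.mapsTo hz₀) ((hIC hz₀).trans h01)
    have h3 := hCCC hz₁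
    simp only [Function.comp, id] at h3
    rcases h1 with h1 | h1
    · rw [h1] at h3
      rcases h2 with h2 | h2
      · rw [h2, h2] at h3
        exact absurd h3 hne
      · rw [h2, h1] at h3
        exact absurd h3 hne
    · exact h1
  -- If `I` were injective near the fixed point `z₁`, then `I ∘ C = I` would force `C = id`, so `τ`
  -- would be trivial, contradicting transitivity.
  have hCid : EqOn C id disk := by
    refine AnalyticOnNhd.eqOn_of_preconnected_of_eventuallyEq hC.analyticOnNhd
      analyticOnNhd_id isPreconnected_disk hz₁ ?_
    obtain ⟨U, hU, hinj⟩ := hI.eventually_injOn hz₁ hd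
    filter_upwards [hU, (hC.analyticOnNhd z₁ hz₁).continuousAt.eventually_mem (by rwa [hC1]),
      isOpen_disk.mem_nhds hz₁] with z hz1 hz2 hz3
    exact hinj hz2 hz1 (hIC hz3)
  have hfix : ∀ g, τ g = g := fun g => by
    refine hI.ev_injective h0 ?_
    rw [← hCL' 0 _ (hI.isMarking_ev h0)]
    exact hCid g.ev_mem.1
  have : Nontrivial (Branch I) := Fintype.one_lt_card_iff_nontrivial.1 (by omega)
  obtain ⟨g, h, hgh⟩ := exists_pair_ne (Branch I)
  obtain ⟨j, hj⟩ := htrans g h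
  rw [show τ = 1 from Equiv.ext hfix, one_zpow] at hj
  exact hgh hj

/-! ### Computations with an explicit cubic -/

theorem deriv_eq_of_eventuallyEq_sub_mul {f h : ℂ → ℂ} {a c : ℂ}
    (hh : DifferentiableAt ℂ h a) (hf : f =ᶠ[𝓝 a] fun z => c + (z - a) * h z) :
    deriv f a = h a := by
  rw [hf.deriv_eq]
  have h1 : HasDerivAt (fun z => z - a) 1 a := (hasDerivAt_id a).sub_const a
  have h2 := (h1.fun_mul hh.hasDerivAt).const_add c
  simpa using h2.deriv

/-- A finite Blaschke product of order three with zeros `0`, `16 / 17` and `5 / 22`. -/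
noncomputable def cubicExample (z : ℂ) : ℂ :=
  z * (17 * z - 16) * (22 * z - 5) / ((17 - 16 * z) * (22 - 5 * z))

theorem cubicExample_den_ne_zero {z : ℂ} (hz : z ∈ disk) :
    17 - 16 * z ≠ 0 ∧ 22 - 5 * z ≠ 0 := by
  have hz' := mem_disk.1 hz
  constructor
  · intro h
    have h1 : (17 : ℂ) = 16 * z := sub_eq_zero.1 h
    have h2 := congrArg norm h1
    rw [norm_mul] at h2
    norm_num at h2
    linarith
  · intro h
    have h1 : (22 : ℂ) = 5 * z := sub_eq_zero.1 h
    have h2 := congrArg norm h1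
    rw [norm_mul] at h2
    norm_num at h2
    linarith

theorem isBlaschke_cubicExample : IsBlaschke 3 cubicExample := by
  refine isBlaschke_iff.2 ⟨by norm_num, 1, ![0, 16 / 17, 5 / 22], by simp, ?_, ?_⟩
  · intro k
    rw [mem_disk]
    fin_cases k <;> norm_num
  · intro z hz
    obtain ⟨h1, h2⟩ := cubicExample_den_ne_zero hz
    have h3 : 1 - 16 / 17 * z ≠ 0 := fun h => h1 (by linear_combination 17 * h)
    have h4 : 1 - 5 / 22 * z ≠ 0 := fun h => h2 (by linear_combination 22 * h)
    have e1 : (starRingEnd ℂ) (16 / 17) = 16 / 17 := by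
      rw [map_div₀, map_ofNat, map_ofNat]
    have e2 : (starRingEnd ℂ) (5 / 22) = 5 / 22 := by
      rw [map_div₀, map_ofNat, map_ofNat]
    simp only [Fin.prod_univ_three, blaschkeFactor, cubicExample, Matrix.cons_val_zero,
      Matrix.cons_val_one, Matrix.cons_val, e1, e2, map_zero, zero_mul, sub_zero, div_one, one_mul]
    have e3 : (z - 16 / 17) / (1 - 16 / 17 * z) = (17 * z - 16) / (17 - 16 * z) := by
      rw [div_eq_div_iff h3 h1]; ring
    have e4 : (z - 5 / 22) / (1 - 5 / 22 * z) = (22 * z - 5) / (22 - 5 * z) := by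
      rw [div_eq_div_iff h4 h2]; ring
    rw [e3, e4]
    field_simp

/-- Splitting off the value `c` and a factor `z - a` in the numerator lets the derivative be read
off. -/
theorem deriv_cubicExample {a c : ℂ} {p : ℂ → ℂ} (ha : a ∈ disk) (hp : DifferentiableAt ℂ p a)
    (h : ∀ z, z * (17 * z - 16) * (22 * z - 5) =
      c * ((17 - 16 * z) * (22 - 5 * z)) + (z - a) * p z) :
    deriv cubicExample a = p a / ((17 - 16 * a) * (22 - 5 * a)) := by
  have hden := cubicExample_den_ne_zero ha
  refine deriv_eq_of_eventuallyEq_sub_mul (c := c)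
    (h := fun z => p z / ((17 - 16 * z) * (22 - 5 * z)))
    (hp.fun_div (by fun_prop) (mul_ne_zero hden.1 hden.2)) ?_
  filter_upwards [isOpen_disk.mem_nhds ha] with z hz
  obtain ⟨h1, h2⟩ := cubicExample_den_ne_zero hz
  rw [cubicExample, h, add_div, mul_div_assoc (z - a), mul_div_cancel_right₀ _ (mul_ne_zero h1 h2)]

theorem deriv_cubicExample_zero : deriv cubicExample 0 = ((40 / 187 : ℝ) : ℂ) := by
  rw [deriv_cubicExample (c := 0) (p := fun z => (17 * z - 16) * (22 * z - 5)) zero_mem_disk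
    (by fun_prop) (fun z => by ring)]
  norm_num

theorem isNormalized_cubicExample : IsNormalized cubicExample := by
  refine ⟨by simp [cubicExample], ?_, ?_⟩
  · rw [deriv_cubicExample_zero]
    refine ⟨?_, Complex.ofReal_im _⟩
    rw [Complex.ofReal_re]
    norm_num
  · rintro ⟨z, hz, hd, hz0⟩
    have hden := cubicExample_den_ne_zero hz
    have hmem : (16 / 17 : ℂ) ∈ disk ∧ (5 / 22 : ℂ) ∈ disk := by
      constructor <;> rw [mem_disk] <;> norm_num
    rw [cubicExample, div_eq_zero_iff, or_iff_left (mul_ne_zero hden.1 hden.2), mul_eq_zero,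
      mul_eq_zero] at hz0
    rcases hz0 with (rfl | h) | h
    · rw [deriv_cubicExample_zero, Complex.ofReal_eq_zero] at hd
      norm_num at hd
    · obtain rfl : z = 16 / 17 := by linear_combination h / 17
      rw [deriv_cubicExample (c := 0) (p := fun z => 17 * z * (22 * z - 5)) hmem.1
        (by fun_prop) (fun z => by ring)] at hd
      norm_num at hd
    · obtain rfl : z = 5 / 22 := by linear_combination h / 22
      rw [deriv_cubicExample (c := 0) (p := fun z => 22 * z * (17 * z - 16)) hmem.2
        (by fun_prop) (fun z => by ring)] at hd
      norm_num at hd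

/-- Over `-8 / 25` the fiber polynomial is `374 (z - 4/5)² (z + 1/2)` with `374 = 17 · 22`: a double
and a simple point. -/
theorem cubicExample_fiber {z : ℂ} (hz : z ∈ disk) :
    cubicExample z = -8 / 25 ↔ z = 4 / 5 ∨ z = -1 / 2 := by
  obtain ⟨h1, h2⟩ := cubicExample_den_ne_zero hz
  rw [cubicExample, div_eq_iff (mul_ne_zero h1 h2)]
  constructor
  · intro h
    have h3 : (z - 4 / 5) ^ 2 * (z - -1 / 2) = 0 := by linear_combination h / 374
    rcases mul_eq_zero.1 h3 with h4 | h4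
    · exact Or.inl (sub_eq_zero.1 (pow_eq_zero_iff two_ne_zero |>.1 h4))
    · exact Or.inr (sub_eq_zero.1 h4)
  · rintro (rfl | rfl) <;> norm_num

theorem deriv_cubicExample_ne_zero : deriv cubicExample (-1 / 2) ≠ 0 := by
  rw [deriv_cubicExample (c := -8 / 25) (p := fun z => 374 * (z - 4 / 5) ^ 2)
    (by rw [mem_disk]; norm_num) (by fun_prop) (fun z => by ring)]
  norm_num

theorem isBlaschke_id : IsBlaschke 1 id :=
  (isBlaschke_blaschkeFactor zero_mem_disk).congr fun z _ => by simp [blaschkeFactor]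

theorem IsBlaschke.card_branch {n : ℕ} {I : ℂ → ℂ} (hI : IsBlaschke n I)
    (h0 : (0 : ℂ) ∉ criticalValues I) [Fintype (Branch I)] : Fintype.card (Branch I) = n := by
  obtain ⟨z₀, hz₀, hIz₀⟩ := hI.surjOn zero_mem_disk
  obtain ⟨g, -⟩ := hI.exists_branch h0 hz₀ hIz₀
  -- For the factorization `id ∘ I` all branches form a single class.
  obtain ⟨S, hS, hmem⟩ := exists_fiber_branches hI h0 isBlaschke_id hI (fun z _ => rfl) g
  rw [← hS, ← Finset.card_univ]
  congr 1
  ext h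
  simp [hmem, h.ev_mem.2, g.ev_mem.2]

/-- `N` is the kernel of the sign. It contains the transitive `τ`, so it is nontrivial and has one
orbit, which is the partition given by `b = I`. It is proper because the cubic has a simple point in
a two-point fiber. -/
theorem exists_normal_associated_trivial :
    ∃ (n : ℕ) (I : ℂ → ℂ), IsBlaschke n I ∧ IsNormalized I ∧
      ∃ N : Subgroup (monodromyGroup I), N.Normal ∧ N ≠ ⊥ ∧ N ≠ ⊤ ∧
        ∃ J b : ℂ → ℂ, IsFactorization I J b ∧ Associated N b ∧
          (IsBlaschke 1 J ∨ IsBlaschke 1 b) := by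
  classical
  have hI := isBlaschke_cubicExample
  have hn := isNormalized_cubicExample
  have h0 := hn.2.2
  refine ⟨3, cubicExample, hI, hn, ?_⟩
  have := hI.finite_branch h0
  have := Fintype.ofFinite (Branch cubicExample)
  have hcard := hI.card_branch h0
  have : Nontrivial (Branch cubicExample) := Fintype.one_lt_card_iff_nontrivial.1 (by omega)
  obtain ⟨τ, hτ, htrans⟩ := hI.exists_transitive_cyclic h0
  obtain ⟨g, h, hgh⟩ := exists_pair_ne (Branch cubicExample)
  have hmove : ∀ x, τ x ≠ x := by
    intro x hx
    have hall : ∀ y, y = x := fun y => by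
      obtain ⟨j, rfl⟩ := htrans x y
      exact Equiv.Perm.zpow_apply_eq_self_of_apply_eq_self hx j
    exact hgh ((hall g).trans (hall h).symm)
  have hsign : Equiv.Perm.sign τ = 1 := by
    rcases sign_eq_one_or_exists_fixed hcard τ with h | ⟨x, hx⟩
    · exact h
    · exact absurd hx (hmove x)
  set N : Subgroup (monodromyGroup cubicExample) :=
    (Equiv.Perm.sign.comp (monodromyGroup cubicExample).subtype).ker with hN
  have hτN : (⟨τ, hτ⟩ : monodromyGroup cubicExample) ∈ N := hsign
  refine ⟨N, MonoidHom.normal_ker _, fun hbot => ?_, fun htop => ?_, id, cubicExample,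
    ⟨⟨1, isBlaschke_id⟩, ⟨3, hI⟩, fun z _ => rfl⟩, ?_, Or.inl isBlaschke_id⟩
  · rw [hbot, Subgroup.mem_bot] at hτN
    exact hmove g (by rw [show τ = 1 from congrArg Subtype.val hτN]; rfl)
  · have hall : ∀ σ ∈ monodromyGroup cubicExample, Equiv.Perm.sign σ = 1 := fun σ hσ => by
      have h1 : (⟨σ, hσ⟩ : monodromyGroup cubicExample) ∈ N := by
        rw [htop]
        trivial
      exact h1
    have hm : (4 / 5 : ℂ) ∈ disk ∧ (-1 / 2 : ℂ) ∈ disk := by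
      constructor <;> rw [mem_disk] <;> norm_num
    have e1 := (cubicExample_fiber hm.1).2 (Or.inl rfl)
    have e2 := (cubicExample_fiber hm.2).2 (Or.inr rfl)
    refine deriv_cubicExample_ne_zero (hI.deriv_eq_zero_of_sign_eq_one h0 hcard hall hm.2
      (z₀ := 4 / 5) (by norm_num) hm.1 (e1.trans e2.symm) fun z hz hzz => ?_)
    exact (cubicExample_fiber hz).1 (hzz.trans e2)
  · rw [associated_iff h0 isBlaschke_id hI fun z _ => rfl]
    intro x y
    rw [x.ev_mem.2, y.ev_mem.2]
    refine iff_of_true ?_ rfl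
    obtain ⟨j, hj⟩ := htrans x y
    exact ⟨⟨⟨τ, hτ⟩ ^ j, zpow_mem hτN j⟩, by
      rw [← hj]
      change ((⟨τ, hτ⟩ ^ j : monodromyGroup cubicExample) : Equiv.Perm _) x = _
      rw [Subgroup.coe_zpow]⟩

end FiniteBlaschke

open FiniteBlaschke in
theorem mainTheorem2 :
    (∀ (n : ℕ) (I : ℂ → ℂ), FiniteBlaschke.IsBlaschke n I →
      (0 : ℂ) ∉ FiniteBlaschke.criticalValues I →
      -- every normal subgroup has an associated factorization, given by an explicit construction
      (∀ N : Subgroup (FiniteBlaschke.monodromyGroup I), N.Normal →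
        ∃ J b : ℂ → ℂ, FiniteBlaschke.IsFactorization I J b ∧
          FiniteBlaschke.Associated N b ∧ FiniteBlaschke.IsOrbitProduct N b) ∧
      -- the factorization associated with a normal subgroup is unique up to equivalence
      (∀ N : Subgroup (FiniteBlaschke.monodromyGroup I), N.Normal →
        ∀ J b J' b' : ℂ → ℂ, FiniteBlaschke.IsFactorization I J b →
          FiniteBlaschke.IsFactorization I J' b' →
          FiniteBlaschke.Associated N b → FiniteBlaschke.Associated N b' →
          FiniteBlaschke.EquivalentFactorizations J b J' b') ∧
      -- every factorization is associated with a normal subgroup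
      (∀ J b : ℂ → ℂ, FiniteBlaschke.IsFactorization I J b →
        (FiniteBlaschke.factorSubgroup I b).Normal ∧
        FiniteBlaschke.Associated (FiniteBlaschke.factorSubgroup I b) b) ∧
      -- every non-trivial factorization comes from a non-trivial proper normal subgroup and is,
      -- up to equivalence, the one constructed from that subgroup
      (∀ J b : ℂ → ℂ, FiniteBlaschke.IsNontrivialFactorization I J b →
        (FiniteBlaschke.factorSubgroup I b).Normal ∧
        FiniteBlaschke.factorSubgroup I b ≠ ⊥ ∧ FiniteBlaschke.factorSubgroup I b ≠ ⊤ ∧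
        ∃ J' b' : ℂ → ℂ, FiniteBlaschke.IsFactorization I J' b' ∧
          FiniteBlaschke.IsOrbitProduct (FiniteBlaschke.factorSubgroup I b) b' ∧
          FiniteBlaschke.EquivalentFactorizations J b J' b') ∧
      -- inequivalent factorizations correspond to different normal subgroups, and conversely
      (∀ J b J' b' : ℂ → ℂ, FiniteBlaschke.IsFactorization I J b →
        FiniteBlaschke.IsFactorization I J' b' →
        (FiniteBlaschke.factorSubgroup I b = FiniteBlaschke.factorSubgroup I b' ↔
          FiniteBlaschke.EquivalentFactorizations J b J' b'))) ∧
    -- a non-trivial proper normal subgroup may be associated with a trivial factorization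
    (∃ (n : ℕ) (I : ℂ → ℂ), FiniteBlaschke.IsBlaschke n I ∧ FiniteBlaschke.IsNormalized I ∧
      ∃ N : Subgroup (FiniteBlaschke.monodromyGroup I), N.Normal ∧ N ≠ ⊥ ∧ N ≠ ⊤ ∧
        ∃ J b : ℂ → ℂ, FiniteBlaschke.IsFactorization I J b ∧ FiniteBlaschke.Associated N b ∧
          (FiniteBlaschke.IsBlaschke 1 J ∨ FiniteBlaschke.IsBlaschke 1 b)) := by
  refine ⟨fun n I hI h0 => ⟨?_, ?_, ?_, ?_, ?_⟩, exists_normal_associated_trivial⟩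
  · intro N hN
    obtain ⟨J, C, m, k, hJ, hC, heq, hNC⟩ := hI.exists_associated h0 hN
    obtain ⟨φ, hφ, hφN⟩ := exists_isOrbitProduct hI h0 hJ hC heq hNC
    obtain ⟨J', m', k', hJ', hb', heq', -⟩ := exists_equivalent_factorization hJ hC heq hφ
    refine ⟨J', φ ∘ C, ⟨⟨m', hJ'⟩, ⟨k', hb'⟩, heq'⟩, ?_, hφN⟩
    -- Composing `C` with the injective `φ` leaves the partition of the branches unchanged.
    rw [associated_iff h0 hJ hC heq] at hNC
    rw [associated_iff h0 hJ' hb' heq']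
    intro g h
    rw [hNC]
    exact (hφ.injOn.eq_iff (hC.mapsTo h.ev_mem.1) (hC.mapsTo g.ev_mem.1)).symm
  · rintro N - J b J' b' ⟨⟨m, hJ⟩, ⟨k, hb⟩, heq⟩ ⟨⟨m', hJ'⟩, ⟨k', hb'⟩, heq'⟩ hN hN'
    exact equivalentFactorizations_of_associated hI h0 hJ hb heq hJ' hb' heq' hN hN'
  · rintro J b ⟨⟨m, hJ⟩, ⟨k, hb⟩, heq⟩
    exact ⟨normal_factorSubgroup hI h0 hJ hb heq, associated_factorSubgroup hI h0 hJ hb heq⟩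
  · rintro J b ⟨⟨m, hm, hJ⟩, ⟨k, hk, hb⟩, heq⟩
    obtain ⟨φ, hφ, hφN⟩ := exists_isOrbitProduct hI h0 hJ hb heq
      (associated_factorSubgroup hI h0 hJ hb heq)
    obtain ⟨J', m', k', hJ', hb', heq', hJφ⟩ := exists_equivalent_factorization hJ hb heq hφ
    exact ⟨normal_factorSubgroup hI h0 hJ hb heq, factorSubgroup_ne_bot hI h0 hJ hb heq hk,
      factorSubgroup_ne_top hI h0 hJ hb heq hm, J', φ ∘ b, ⟨⟨m', hJ'⟩, ⟨k', hb'⟩, heq'⟩, hφN,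
      φ, hφ, fun z _ => rfl, hJφ⟩
  · rintro J b J' b' ⟨⟨m, hJ⟩, ⟨k, hb⟩, heq⟩ ⟨⟨m', hJ'⟩, ⟨k', hb'⟩, heq'⟩
    refine ⟨fun h => ?_, factorSubgroup_eq_of_equivalent h0 hJ hb heq hJ' hb' heq'⟩
    refine equivalentFactorizations_of_associated hI h0 hJ hb heq hJ' hb' heq'
      (associated_factorSubgroup hI h0 hJ hb heq) ?_
    rw [h]
    exact associated_factorSubgroup hI h0 hJ' hb' heq'
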